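/- **Setting.** Let $\pi=(\pi^n)_{n\ge 0}$ be a sequence of partitions $\pi^n=(0=t^n_0<t^n_1<\dots<t^n_{N(\pi^n)}=1)$ of $[0,1]$ with $\pi^0=\{0,1\}$, and let $|\pi^n|$ and $\underline{\pi^n}$ be the lengths of the largest and of the smallest interval of $\pi^n$. Assume that $\pi$ is *refining* ($\pi^m\subseteq\pi^n$ for $1\le m\le n$), *balanced* (there is $c>1$ with $|\pi^n|/\underline{\pi^n}\le c$ for all $n\ge1$) and *complete refining* (there are $a,b>0$ with $1+a\le|\pi^n|/|\pi^{n+1}|\le b$ for all $n\ge 1$). For $m\ge0$ let $p(m,k)$ be the index of $t^m_k$ in $\pi^{m+1}$, and let $I_m$ be the set of pairs $\kappa=(k,i)$ with $0\le k<N(\pi^m)$ and $2\le i\le p(m,k+1)-p(m,k)$. For $\kappa=(k,i)\in I_m$ put $t_1^{m,\kappa}=t^{m+1}_{p(m,k)}$, $t_2^{m,\kappa}=t^{m+1}_{p(m,k)+i-1}$, $t_3^{m,\kappa}=t^{m+1}_{p(m,k)+i}$, $\Delta^{m,\kappa}_1=t_2^{m,\kappa}-t_1^{m,\kappa}$, $\Delta^{m,\kappa}_2=t_3^{m,\kappa}-t_2^{m,\kappa}$.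 The Schauder function $e_{m,\kappa}$ is zero outside $[t_1,t_3)$ and $$e_{m,\kappa}(t)=\Big(\tfrac{\Delta_2}{\Delta_1}\tfrac1{\Delta_1+\Delta_2}\Big)^{1/2}(t-t_1)\ \text{ on }[t_1,t_2),\qquad e_{m,\kappa}(t)=\Big(\tfrac{\Delta_1}{\Delta_2}\tfrac1{\Delta_1+\Delta_2}\Big)^{1/2}(t_3-t)\ \text{ on }[t_2,t_3)$$ (indices $m,\kappa$ omitted). The Schauder coefficients of $x:[0,1]\to\mathbb R$ are $$\theta^{x}_{m,\kappa}=\frac{(x(t_2)-x(t_1))\Delta_2-(x(t_3)-x(t_2))\Delta_1}{\sqrt{\Delta_1\Delta_2(\Delta_1+\Delta_2)}} .$$ Fix $H\in(0,1)$, and let $R(s,t)=\frac12(|s|^{2H}+|t|^{2H}-|t-s|^{2H})$. A fractional Brownian motion (fBM) $B^H$ on $[0,1]$ is a continuous centered Gaussian process with covariance $R$. Put $$\xi(s,t;u,v)=\tfrac12\big(|t-u|^{2H}+|s-v|^{2H}-|t-v|^{2H}-|s-u|^{2H}\big)$$ (the covariance of $B^H(t)-B^H(s)$ and $B^H(v)-B^H(u)$),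 and, with $t_j,\Delta_j$ belonging to $(m,\kappa)$ and $t_j',\Delta_j'$ to $(m',\kappa')$, $$\sigma_{m,\kappa,m',\kappa'}=\frac{\Delta_2\Delta_2'\,\xi(t_1,t_2;t_1',t_2')+\Delta_1\Delta_1'\,\xi(t_2,t_3;t_2',t_3')-\Delta_1\Delta_2'\,\xi(t_2,t_3;t_1',t_2')-\Delta_1'\Delta_2\,\xi(t_1,t_2;t_2',t_3')}{\sqrt{\Delta_1\Delta_2\Delta_1'\Delta_2'(\Delta_1+\Delta_2)(\Delta_1'+\Delta_2')}},$$ $$\sigma_{-1,0,m,\kappa}=\frac{\Delta_2\,\xi(0,1;t_1,t_2)-\Delta_1\,\xi(0,1;t_2,t_3)}{\sqrt{\Delta_1\Delta_2(\Delta_1+\Delta_2)}} .$$ $C^{H-}([0,1],\mathbb R)$ is the set of continuous functions on $[0,1]$ that are $\alpha$-Hölder continuous on $[0,1]$ for every $0\le\alpha<H$. $\pi$ *consists of uniform partitions* if $|\pi^n|=\underline{\pi^n}$ for all $n\ge1$. For a process $X$ on $[0,1]$ the scaled quadratic variation is $$Q^X_n(t)=\Big(\frac{1}{\lfloor t/|\pi^n|\rfloor}\Big)^{1-2H}\sum_{i:\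 t^n_{i+1}\le t}|X(t^n_{i+1})-X(t^n_i)|^2\qquad(Q_n^X(t)=0\text{ if there are no summands}).$$ **Theorem.** Let $\theta_{m,\kappa}$ ($m\ge0$, $\kappa\in I_m$) be random variables on a probability space such that (a) $\mathbb E[\theta_{m,\kappa}]=0$ and $\mathbb E[\theta_{m,\kappa}\theta_{m',\kappa'}]=\sigma_{m,\kappa,m',\kappa'}$ for all indices; (b) there are $C_1,C_2>0$ with $\mathbb P\big[|\theta_{m,\kappa}|\,|\pi^{m+1}|^{\frac12-H}>\delta\big]\le C_1\exp\big(-\tfrac{\delta^2}{2C_2}\big)$ for all $\delta>0$, $m\ge0$, $\kappa\in I_m$. Let $Y_0(t)=\sum_{m=0}^\infty\sum_{\kappa\in I_m}\theta_{m,\kappa}e_{m,\kappa}(t)$, $t\in[0,1]$. *Part 1 (without linear term).* Almost surely the partial sums $\sum_{m=0}^{n}\sum_{\kappa\in I_m}\theta_{m,\kappa}e_{m,\kappa}$ converge uniformly on $[0,1]$ to $Y_0$, and $Y_0$ is continuous. The variables $Y_0(t)$ are square integrable with mean $0$ and have the covariance of $B^H(t)-B^H(1)t$: $$\mathbb E[Y_0(t)Y_0(s)]=R(t,s)-tR(1,s)-sR(t,1)+ts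 .$$ Almost every path of $Y_0$ belongs to $C^{H-}([0,1],\mathbb R)$. The $\theta_{m,\kappa}$ are square integrable, and for every fBM $B^H$ on any probability space $\mathbb E[\theta_{m,\kappa}]=\mathbb E[\theta^{B^H}_{m,\kappa}]$ and $\mathbb E[\theta_{m,\kappa}\theta_{m',\kappa'}]=\mathbb E[\theta^{B^H}_{m,\kappa}\theta^{B^H}_{m',\kappa'}]$. If $\pi$ consists of uniform partitions, then $\lim_{n\to\infty}\mathbb E[Q_n^{Y_0}(t)]=t^{2H}$ for every $t\in[0,1]$. *Part 2 (fake fBM).* Let moreover $Z$ be a random variable with $\mathbb E[Z]=0$, $\mathbb E[Z^2]=1$ and $\mathbb E[Z\theta_{m,\kappa}]=\sigma_{-1,0,m,\kappa}$ for all $m\ge0$, $\kappa\in I_m$, and let $Y^H(t)=Zt+Y_0(t)$. Then: (i) $Y^H$ is almost surely continuous on $[0,1]$. (ii) For all $s,t\in[0,1]$, $Y^H(t)$ is square integrable, $\mathbb E[Y^H(t)]=0$ and $2\mathbb E[Y^H(t)Y^H(s)]=|t|^{2H}+|s|^{2H}-|t-s|^{2H}$. (iii) For all $0\le s\le t\le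 u\le v\le1$, $$2\mathbb E[(Y^H(t)-Y^H(s))(Y^H(v)-Y^H(u))]=|t-u|^{2H}+|s-v|^{2H}-|t-v|^{2H}-|s-u|^{2H},$$ and if $s<t$ and $u<v$ this vanishes if and only if $H=\frac12$. (iv) Almost every path of $Y^H$ belongs to $C^{H-}([0,1],\mathbb R)$. (v) $Z$ is square integrable, and for every fBM $B^H$ on any probability space, $\mathbb E[Z]=\mathbb E[B^H(1)]$, $\mathbb E[Z^2]=\mathbb E[B^H(1)^2]$ and $\mathbb E[Z\theta_{m,\kappa}]=\mathbb E[B^H(1)\theta^{B^H}_{m,\kappa}]$ (in addition to the identities for the $\theta_{m,\kappa}$ in Part 1). (vi) If $\pi$ consists of uniform partitions, then $\lim_{n\to\infty}\mathbb E[Q_n^{Y^H}(t)]=t^{2H}$ for every $t\in[0,1]$. -/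

import Mathlib

open MeasureTheory ProbabilityTheory Filter Topology Set
open scoped NNReal

noncomputable section

namespace FakeFBM

/-- A sequence of partitions `π^n = (0 = t n 0 < t n 1 < ... < t n (N n) = 1)` of `[0, 1]`, with the
convention `π^0 = {0, 1}`. Here `N n` is the number of intervals of `π^n`; the values `t n i` with
`i > N n` carry no meaning and are never used. -/
structure PartitionSeq where
  N : ℕ → ℕ
  t : ℕ → ℕ → ℝ
  t_first : ∀ n, t n 0 = 0
  t_last : ∀ n, t n (N n) = 1
  t_lt : ∀ n, ∀ i < N n, t n i < t n (i + 1)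
  N_zero : N 0 = 1

namespace PartitionSeq

variable (π : PartitionSeq)

/-- The set of partition points of `π^n`. -/
def points (n : ℕ) : Set ℝ := {x | ∃ i ≤ π.N n, x = π.t n i}

/-- The size `|π^n|` of the largest interval of `π^n`. -/
def mesh (n : ℕ) : ℝ := ⨆ i : Fin (π.N n), (π.t n (i + 1) - π.t n i)

/-- The size of the smallest interval of `π^n`. -/
def minMesh (n : ℕ) : ℝ := ⨅ i : Fin (π.N n), (π.t n (i + 1) - π.t n i)

/-- Refining (nested) sequence of partitions. -/
def Refining : Prop := ∀ m n, 1 ≤ m → m ≤ n → π.points m ⊆ π.points n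

/-- Balanced sequence of partitions. -/
def Balanced : Prop := ∃ c : ℝ, 1 < c ∧ ∀ n, 1 ≤ n → π.mesh n / π.minMesh n ≤ c

/-- Complete refining sequence of partitions. -/
def CompleteRefining : Prop :=
  π.Refining ∧ ∃ a b : ℝ, 0 < a ∧ 0 < b ∧
    ∀ n, 1 ≤ n → 1 + a ≤ π.mesh n / π.mesh (n + 1) ∧ π.mesh n / π.mesh (n + 1) ≤ b

/-- All partitions of the sequence are uniform. -/
def Uniform : Prop := ∀ n, 1 ≤ n → π.mesh n = π.minMesh n

/-- `p n k = inf {j ≥ 0 : t^{n+1}_j ≥ t^n_k}`, the position of the point `t^n_k` in `π^{n+1}`. -/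
def p (n k : ℕ) : ℕ := sInf {j : ℕ | π.t n k ≤ π.t (n + 1) j}

/-- The index set of the Haar and Schauder functions of level `m`: pairs `κ = (k, i)`, where `k` is
the index of an interval `[t^m_k, t^m_{k+1}]` of `π^m` and `2 ≤ i ≤ p(m,k+1) - p(m,k)`
(so that the point `t^{m+1}_{p(m,k)+i-1}` is one of the points of `π^{m+1}` in the interior of that
interval). There are `N(π^{m+1}) - N(π^m)` such pairs. -/
def I (m : ℕ) : Finset (ℕ × ℕ) :=
  (Finset.range (π.N m) ×ˢ Finset.range (π.N (m + 1) + 1)).filter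
    (fun κ => 2 ≤ κ.2 ∧ κ.2 ≤ π.p m (κ.1 + 1) - π.p m κ.1)

/-- Left end of the support of the Schauder function with index `(m, κ)`. -/
def t₁ (m : ℕ) (κ : ℕ × ℕ) : ℝ := π.t (m + 1) (π.p m κ.1)

/-- Point where the Schauder function with index `(m, κ)` attains its maximum. -/
def t₂ (m : ℕ) (κ : ℕ × ℕ) : ℝ := π.t (m + 1) (π.p m κ.1 + κ.2 - 1)

/-- Right end of the support of the Schauder function with index `(m, κ)`. -/
def t₃ (m : ℕ) (κ : ℕ × ℕ) : ℝ := π.t (m + 1) (π.p m κ.1 + κ.2)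

/-- `Δ₁ = t₂ - t₁`. -/
def Δ₁ (m : ℕ) (κ : ℕ × ℕ) : ℝ := π.t₂ m κ - π.t₁ m κ

/-- `Δ₂ = t₃ - t₂`. -/
def Δ₂ (m : ℕ) (κ : ℕ × ℕ) : ℝ := π.t₃ m κ - π.t₂ m κ

open Classical in
/-- The Schauder function `e^π_{m,κ}`. -/
def e (m : ℕ) (κ : ℕ × ℕ) (s : ℝ) : ℝ :=
  if s ∈ Set.Ico (π.t₁ m κ) (π.t₂ m κ) then
    Real.sqrt (π.Δ₂ m κ / π.Δ₁ m κ * (1 / (π.Δ₁ m κ + π.Δ₂ m κ))) * (s - π.t₁ m κ)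
  else if s ∈ Set.Ico (π.t₂ m κ) (π.t₃ m κ) then
    Real.sqrt (π.Δ₁ m κ / π.Δ₂ m κ * (1 / (π.Δ₁ m κ + π.Δ₂ m κ))) * (π.t₃ m κ - s)
  else 0

/-- The level-`m` block `∑_{κ ∈ I_m} θ_{m,κ} e_{m,κ}` of a Schauder series. -/
def schauderLevel (θ : ℕ → ℕ × ℕ → ℝ) (m : ℕ) (s : ℝ) : ℝ := ∑ κ ∈ π.I m, θ m κ * π.e m κ s

/-- The Schauder series `∑_{m ≥ 0} ∑_{κ ∈ I_m} θ_{m,κ} e_{m,κ}`. -/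
def schauderSum (θ : ℕ → ℕ × ℕ → ℝ) (s : ℝ) : ℝ := ∑' m, π.schauderLevel θ m s

/-- The Schauder coefficients of a function `x` on `[0, 1]`. -/
def schauderCoeff (x : ℝ → ℝ) (m : ℕ) (κ : ℕ × ℕ) : ℝ :=
  ((x (π.t₂ m κ) - x (π.t₁ m κ)) * π.Δ₂ m κ - (x (π.t₃ m κ) - x (π.t₂ m κ)) * π.Δ₁ m κ) /
    Real.sqrt (π.Δ₁ m κ * π.Δ₂ m κ * (π.t₃ m κ - π.t₁ m κ))

end PartitionSeq

/-- Covariance function of fractional Brownian motion with Hurst index `H`. -/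
def fbmCov (H s t : ℝ) : ℝ := (|s| ^ (2 * H) + |t| ^ (2 * H) - |t - s| ^ (2 * H)) / 2

/-- Covariance of the increments `B(t) - B(s)` and `B(v) - B(u)` of fractional Brownian motion. -/
def fbmIncCov (H s t u v : ℝ) : ℝ :=
  (|t - u| ^ (2 * H) + |s - v| ^ (2 * H) - |t - v| ^ (2 * H) - |s - u| ^ (2 * H)) / 2

/-- The covariance `σ_{m,κ,m',κ'}` between the Schauder coefficients of fractional Brownian
motion. -/
def sigma (π : PartitionSeq) (H : ℝ) (m : ℕ) (κ : ℕ × ℕ) (m' : ℕ) (κ' : ℕ × ℕ) : ℝ :=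
  (π.Δ₂ m κ * π.Δ₂ m' κ' * fbmIncCov H (π.t₁ m κ) (π.t₂ m κ) (π.t₁ m' κ') (π.t₂ m' κ')
    + π.Δ₁ m κ * π.Δ₁ m' κ' * fbmIncCov H (π.t₂ m κ) (π.t₃ m κ) (π.t₂ m' κ') (π.t₃ m' κ')
    - π.Δ₁ m κ * π.Δ₂ m' κ' * fbmIncCov H (π.t₂ m κ) (π.t₃ m κ) (π.t₁ m' κ') (π.t₂ m' κ')
    - π.Δ₁ m' κ' * π.Δ₂ m κ * fbmIncCov H (π.t₁ m κ) (π.t₂ m κ) (π.t₂ m' κ') (π.t₃ m' κ')) /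
  Real.sqrt (π.Δ₁ m κ * π.Δ₂ m κ * π.Δ₁ m' κ' * π.Δ₂ m' κ' *
    (π.Δ₁ m κ + π.Δ₂ m κ) * (π.Δ₁ m' κ' + π.Δ₂ m' κ'))

/-- The covariance `σ_{-1,0,m,κ}` between the coefficient `B(1)` of the linear function `t ↦ t` and
the Schauder coefficient with index `(m, κ)` of fractional Brownian motion `B`. -/
def sigmaLin (π : PartitionSeq) (H : ℝ) (m : ℕ) (κ : ℕ × ℕ) : ℝ :=
  (π.Δ₂ m κ * fbmIncCov H 0 1 (π.t₁ m κ) (π.t₂ m κ)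
    - π.Δ₁ m κ * fbmIncCov H 0 1 (π.t₂ m κ) (π.t₃ m κ)) /
  Real.sqrt (π.Δ₁ m κ * π.Δ₂ m κ * (π.Δ₁ m κ + π.Δ₂ m κ))

/-- `B` is a fractional Brownian motion on `[0, 1]` with Hurst index `H`: a continuous centered
Gaussian process with the covariance function of fractional Brownian motion. -/
structure IsFBM {Ω : Type*} [MeasurableSpace Ω] (H : ℝ) (B : ℝ → Ω → ℝ) (P : Measure Ω) :
    Prop where
  gaussian : IsGaussianProcess (fun (t : Set.Icc (0 : ℝ) 1) ω => B t ω) P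
  mean : ∀ t ∈ Set.Icc (0 : ℝ) 1, ∫ ω, B t ω ∂P = 0
  cov : ∀ s ∈ Set.Icc (0 : ℝ) 1, ∀ t ∈ Set.Icc (0 : ℝ) 1, ∫ ω, B s ω * B t ω ∂P = fbmCov H s t
  cont : ∀ᵐ ω ∂P, ContinuousOn (fun t => B t ω) (Set.Icc 0 1)

/-- `f` belongs to `C^{H-}([0, 1], ℝ)`, i.e. `f` is continuous on `[0, 1]` and Hölder continuous on
`[0, 1]` of every order `0 ≤ α < H`. -/
def InHolderMinus (H : ℝ) (f : ℝ → ℝ) : Prop :=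
  ContinuousOn f (Set.Icc 0 1) ∧
    ∀ α : ℝ≥0, (α : ℝ) < H → ∃ C : ℝ≥0, HolderOnWith C α f (Set.Icc 0 1)

/-- The scaled quadratic variation up to time `t` of the process `Y` along the (uniform) partition
`π^n`; `⌊t / |π^n|⌋` is the number of summands. The value is `0` if there are no summands. -/
def scaledQV {Ω : Type*} (π : PartitionSeq) (H : ℝ) (Y : ℝ → Ω → ℝ) (n : ℕ) (t : ℝ) (ω : Ω) : ℝ :=
  ((⌊t / π.mesh n⌋₊ : ℝ)⁻¹) ^ (1 - 2 * H) *
    ∑ i ∈ (Finset.range (π.N n)).filter (fun i => π.t n (i + 1) ≤ t),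
      (Y (π.t n (i + 1)) ω - Y (π.t n i) ω) ^ 2

end FakeFBM

end

open FakeFBM

/-!
A Schauder series whose coefficients have the first two moments of the Schauder coefficients of
fractional Brownian motion has the first two moments of fractional Brownian motion, and Gaussian
tails of the coefficients are enough for its path regularity. Both halves rest on the geometry of
the partitions.

*Moments.* The first `n` levels of the Schauder expansion of a function `x`, together with its
linear part, interpolate `x` linearly along `π^n` (`sum_schauderLevel_eq_linInterp`): on an interval
of `π^m`, the terms of level `m` are the differences of the interpolations before and after removal
of a point of `π^{m+1}`, so that their sum telescopes. The matrix `σ` arises from the covariance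
`R` of fBM when the Schauder coefficient functional is applied in both variables
(`sigma_eq_schauderCoeff`). At points of `π^n` the series is a finite sum, and expanding `R` in each
variable shows that its covariance there is
`R(t, s) - t R(1, s) - s R(t, 1) + t s` (`integral_sum_schauderLevel_mul`); no fBM has to exist for
this. The partition points are dense, the kernel is continuous and the paths are continuous, so that
the values at partition points converge almost surely and in `L²`
(`exists_tendsto_toLp_schauderSum`), and the formula extends to `[0, 1]`. The linear term `Z t` adds
what `B(t) - B(1) t` lacks.

*Paths.* The number of coefficients of level `m` grows geometrically, so by Borel–Cantelli
`|θ_{m,κ}| |π^{m+1}|^{1/2-H} ≤ C (m + 1)` almost surely for all indices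
(`ae_exists_coeff_bound`). A Schauder function of level `m` is bounded by `|π^{m+1}|^{1/2}` and has
slopes of order `|π^{m+1}|^{-1/2}`, and at each point only boundedly many of them are nonzero.
Interpolating between the two bounds, the `α`-Hölder constant of level `m` is of order
`(m + 1) |π^{m+1}|^{H-α}`, which is summable for `α < H` since the mesh decays geometrically
(`exists_summable_holder_bound`). The case `α = 0` gives uniform convergence.

*Quadratic variation.* Along a uniform partition of mesh `μ` with `M = ⌊t / μ⌋` summands the expected
scaled quadratic variation is `(M μ)^{2H}`, plus, without linear term, a correction of order
`μ^{2-2H}` (`Uniform.tendsto_integral_scaledQV`).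
-/

namespace FakeFBM
namespace PartitionSeq

variable {π : PartitionSeq}

/-! ### Geometry of refining partitions -/

theorem t_lt_t {n i j : ℕ} (hij : i < j) (hj : j ≤ π.N n) : π.t n i < π.t n j := by
  induction j with
  | zero => omega
  | succ j ih =>
    rcases Nat.lt_succ_iff_lt_or_eq.1 hij with h | rfl
    · exact (ih h (by omega)).trans (π.t_lt n j (by omega))
    · exact π.t_lt n i (by omega)

theorem t_le_t {n i j : ℕ} (hij : i ≤ j) (hj : j ≤ π.N n) : π.t n i ≤ π.t n j := by
  rcases hij.lt_or_eq with h | rfl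
  · exact (t_lt_t h hj).le
  · exact le_rfl

theorem t_mem_Icc {n i : ℕ} (hi : i ≤ π.N n) : π.t n i ∈ Icc (0 : ℝ) 1 :=
  ⟨π.t_first n ▸ t_le_t (Nat.zero_le i) hi, π.t_last n ▸ t_le_t hi le_rfl⟩

theorem N_pos (n : ℕ) : 0 < π.N n := by
  rcases Nat.eq_zero_or_pos (π.N n) with h | h
  · have h1 := π.t_last n
    rw [h, π.t_first] at h1
    norm_num at h1
  · exact h

theorem exists_mem_Icc_t (n : ℕ) {s : ℝ} (hs : s ∈ Icc (0 : ℝ) 1) :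
    ∃ k < π.N n, s ∈ Icc (π.t n k) (π.t n (k + 1)) := by
  have key : ∀ j ≤ π.N n, 0 < j → s ≤ π.t n j → ∃ k < j, s ∈ Icc (π.t n k) (π.t n (k + 1)) := by
    intro j
    induction j with
    | zero => intro _ h; omega
    | succ j ih =>
      intro hj _ hsj
      rcases le_total (π.t n j) s with h | h
      · exact ⟨j, by omega, h, hsj⟩
      · rcases Nat.eq_zero_or_pos j with rfl | h0
        · exact ⟨0, by omega, by rw [π.t_first]; exact hs.1, hsj⟩
        · obtain ⟨k, hk, hk'⟩ := ih (by omega) h0 h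
          exact ⟨k, by omega, hk'⟩
  exact key _ le_rfl (N_pos n) (by rw [π.t_last]; exact hs.2)

theorem sub_le_mesh {n i : ℕ} (hi : i < π.N n) : π.t n (i + 1) - π.t n i ≤ π.mesh n :=
  le_ciSup (f := fun i : Fin (π.N n) => π.t n (i + 1) - π.t n i) (Set.finite_range _).bddAbove
    ⟨i, hi⟩

theorem minMesh_le_sub {n i : ℕ} (hi : i < π.N n) : π.minMesh n ≤ π.t n (i + 1) - π.t n i :=
  ciInf_le (f := fun i : Fin (π.N n) => π.t n (i + 1) - π.t n i) (Set.finite_range _).bddBelow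
    ⟨i, hi⟩

theorem minMesh_pos (n : ℕ) : 0 < π.minMesh n := by
  have : Nonempty (Fin (π.N n)) := ⟨⟨0, N_pos n⟩⟩
  obtain ⟨i, hi⟩ := exists_eq_ciInf_of_finite
    (f := fun i : Fin (π.N n) => π.t n (i + 1) - π.t n i)
  rw [minMesh, ← hi]
  exact sub_pos.2 (π.t_lt n i i.2)

theorem minMesh_le_mesh (n : ℕ) : π.minMesh n ≤ π.mesh n :=
  (minMesh_le_sub (N_pos n)).trans (sub_le_mesh (N_pos n))

theorem mesh_pos (n : ℕ) : 0 < π.mesh n := (minMesh_pos n).trans_le (minMesh_le_mesh n)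

theorem mul_minMesh_le {n i j : ℕ} (hj : i + j ≤ π.N n) :
    j * π.minMesh n ≤ π.t n (i + j) - π.t n i := by
  induction j with
  | zero => simp
  | succ j ih =>
    have h1 := ih (by omega)
    have h2 := minMesh_le_sub (π := π) (n := n) (i := i + j) (by omega)
    rw [← add_assoc]
    push_cast
    linarith

theorem N_mul_minMesh_le (n : ℕ) : π.N n * π.minMesh n ≤ 1 := by
  have h := mul_minMesh_le (π := π) (n := n) (i := 0) (j := π.N n) (by omega)
  rwa [zero_add, π.t_last, π.t_first, sub_zero] at h

theorem points_subset_succ (h : π.Refining) (n : ℕ) : π.points n ⊆ π.points (n + 1) := by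
  rcases Nat.eq_zero_or_pos n with rfl | hn
  · rintro x ⟨i, hi, rfl⟩
    rw [π.N_zero] at hi
    interval_cases i
    · exact ⟨0, Nat.zero_le _, by rw [π.t_first, π.t_first]⟩
    · refine ⟨π.N (0 + 1), le_rfl, ?_⟩
      have h1 := π.t_last 0
      rw [π.N_zero] at h1
      rw [h1, π.t_last]
  · exact h n (n + 1) hn (Nat.le_succ n)

theorem points_mono (h : π.Refining) : Monotone π.points :=
  monotone_nat_of_le_succ (points_subset_succ h)

theorem points_subset_Icc (n : ℕ) : π.points n ⊆ Icc 0 1 := by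
  rintro x ⟨i, hi, rfl⟩
  exact t_mem_Icc hi

theorem p_le_of_le {m k j : ℕ} (h : π.t m k ≤ π.t (m + 1) j) : π.p m k ≤ j := Nat.sInf_le h

theorem t_le_t_p {m k : ℕ} (hk : k ≤ π.N m) : π.t m k ≤ π.t (m + 1) (π.p m k) :=
  Nat.sInf_mem (s := {j : ℕ | π.t m k ≤ π.t (m + 1) j})
    ⟨π.N (m + 1), show π.t m k ≤ π.t (m + 1) (π.N (m + 1)) by rw [π.t_last]; exact (t_mem_Icc hk).2⟩

theorem p_le {m k : ℕ} (hk : k ≤ π.N m) : π.p m k ≤ π.N (m + 1) :=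
  p_le_of_le (by rw [π.t_last]; exact (t_mem_Icc hk).2)

/-- By refinement, `t^m_k` is the point of `π^{m+1}` with index `p m k`. -/
theorem t_p (h : π.Refining) {m k : ℕ} (hk : k ≤ π.N m) :
    π.t (m + 1) (π.p m k) = π.t m k := by
  obtain ⟨j, hj, hj'⟩ := points_subset_succ h m ⟨k, hk, rfl⟩
  refine le_antisymm ?_ (t_le_t_p hk)
  rw [hj']
  exact t_le_t (p_le_of_le hj'.le) hj

theorem p_lt_p (h : π.Refining) {m k l : ℕ} (hkl : k < l) (hl : l ≤ π.N m) :
    π.p m k < π.p m l := by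
  by_contra! hc
  have h1 := t_le_t hc (p_le (π := π) (hkl.le.trans hl))
  rw [t_p h hl, t_p h (hkl.le.trans hl)] at h1
  exact absurd (t_lt_t hkl hl) h1.not_gt

theorem mem_I {m k i : ℕ} :
    (k, i) ∈ π.I m ↔ k < π.N m ∧ 2 ≤ i ∧ π.p m k + i ≤ π.p m (k + 1) := by
  simp only [I, Finset.mem_filter, Finset.mem_product, Finset.mem_range]
  constructor
  · rintro ⟨⟨h1, h2⟩, h3, h4⟩
    exact ⟨h1, h3, by omega⟩
  · rintro ⟨h1, h2, h3⟩
    have := p_le (π := π) (m := m) (k := k + 1) h1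
    exact ⟨⟨h1, by omega⟩, h2, by omega⟩

section Index

variable {m : ℕ} {κ : ℕ × ℕ}

theorem t₁_eq (h : π.Refining) (hκ : κ ∈ π.I m) : π.t₁ m κ = π.t m κ.1 :=
  t_p h (mem_I.1 hκ).1.le

theorem t₃_le (h : π.Refining) (hκ : κ ∈ π.I m) : π.t₃ m κ ≤ π.t m (κ.1 + 1) := by
  obtain ⟨h1, h2, h3⟩ := mem_I.1 hκ
  rw [← t_p h h1]
  exact t_le_t h3 (p_le h1)

theorem index_le_N (hκ : κ ∈ π.I m) : π.p m κ.1 + κ.2 ≤ π.N (m + 1) := by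
  obtain ⟨h1, h2, h3⟩ := mem_I.1 hκ
  exact h3.trans (p_le h1)

theorem t₁_mem_Icc (hκ : κ ∈ π.I m) : π.t₁ m κ ∈ Icc (0 : ℝ) 1 :=
  t_mem_Icc (by have := index_le_N hκ; omega)

theorem t₂_mem_Icc (hκ : κ ∈ π.I m) : π.t₂ m κ ∈ Icc (0 : ℝ) 1 :=
  t_mem_Icc (by have := index_le_N hκ; omega)

theorem t₃_mem_Icc (hκ : κ ∈ π.I m) : π.t₃ m κ ∈ Icc (0 : ℝ) 1 :=
  t_mem_Icc (index_le_N hκ)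

theorem minMesh_le_Δ₁ (hκ : κ ∈ π.I m) : π.minMesh (m + 1) ≤ π.Δ₁ m κ := by
  have hN := index_le_N hκ
  have h2 := (mem_I.1 hκ).2.1
  refine (minMesh_le_sub (π := π) (i := π.p m κ.1) (by omega)).trans ?_
  exact sub_le_sub_right (t_le_t (by omega) (by omega)) _

theorem Δ₂_eq (hκ : κ ∈ π.I m) :
    π.Δ₂ m κ = π.t (m + 1) (π.p m κ.1 + κ.2 - 1 + 1) - π.t (m + 1) (π.p m κ.1 + κ.2 - 1) := by
  have h2 := (mem_I.1 hκ).2.1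
  rw [Δ₂, t₃, t₂, Nat.sub_add_cancel (by omega)]

theorem minMesh_le_Δ₂ (hκ : κ ∈ π.I m) : π.minMesh (m + 1) ≤ π.Δ₂ m κ := by
  have hN := index_le_N hκ
  have h2 := (mem_I.1 hκ).2.1
  rw [Δ₂_eq hκ]
  exact minMesh_le_sub (by omega)

theorem Δ₂_le_mesh (hκ : κ ∈ π.I m) : π.Δ₂ m κ ≤ π.mesh (m + 1) := by
  have hN := index_le_N hκ
  have h2 := (mem_I.1 hκ).2.1
  rw [Δ₂_eq hκ]
  exact sub_le_mesh (by omega)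

theorem Δ₁_pos (hκ : κ ∈ π.I m) : 0 < π.Δ₁ m κ :=
  (minMesh_pos _).trans_le (minMesh_le_Δ₁ hκ)

theorem Δ₂_pos (hκ : κ ∈ π.I m) : 0 < π.Δ₂ m κ :=
  (minMesh_pos _).trans_le (minMesh_le_Δ₂ hκ)

end Index

/-! ### Growth of the mesh and of the index sets -/

theorem CompleteRefining.exists_mesh_le (h : π.CompleteRefining) :
    ∃ q C : ℝ, 0 < q ∧ q < 1 ∧ 0 < C ∧ ∀ m, π.mesh (m + 1) ≤ C * q ^ m := by
  obtain ⟨-, a, b, ha, hb, hab⟩ := h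
  refine ⟨(1 + a)⁻¹, π.mesh 1, by positivity, inv_lt_one_of_one_lt₀ (by linarith), mesh_pos 1, ?_⟩
  intro m
  induction m with
  | zero => simp
  | succ m ih =>
    have h1 := (hab (m + 1) (by omega)).1
    rw [le_div_iff₀ (mesh_pos _)] at h1
    rw [pow_succ, ← mul_assoc, ← div_eq_mul_inv, le_div_iff₀ (by positivity)]
    linarith

theorem exists_inv_minMesh_le (hbal : π.Balanced) (h : π.CompleteRefining) :
    ∃ b C : ℝ, 0 < b ∧ 0 < C ∧ ∀ m, (π.minMesh (m + 1))⁻¹ ≤ C * b ^ m := by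
  obtain ⟨c, hc, hbal⟩ := hbal
  obtain ⟨-, a, b, ha, hb, hab⟩ := h
  have key : ∀ m, (π.mesh (m + 1))⁻¹ ≤ (π.mesh 1)⁻¹ * b ^ m := by
    intro m
    induction m with
    | zero => simp
    | succ m ih =>
      have h1 := (hab (m + 1) (by omega)).2
      have h2 : (π.mesh (m + 1 + 1))⁻¹ = (π.mesh (m + 1))⁻¹ *
          (π.mesh (m + 1) / π.mesh (m + 1 + 1)) := by
        have := (mesh_pos (π := π) (m + 1)).ne'
        field_simp
      rw [h2, pow_succ, ← mul_assoc]
      have := mesh_pos (π := π) (m + 1)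
      have := mesh_pos (π := π) (m + 1 + 1)
      have := mesh_pos (π := π) 1
      gcongr
  refine ⟨b, c * (π.mesh 1)⁻¹, hb, mul_pos (by linarith) (inv_pos.2 (mesh_pos 1)), fun m => ?_⟩
  have h1 := hbal (m + 1) (by omega)
  have h2 : (π.minMesh (m + 1))⁻¹ = π.mesh (m + 1) / π.minMesh (m + 1) * (π.mesh (m + 1))⁻¹ := by
    have := (mesh_pos (π := π) (m + 1)).ne'
    field_simp
  rw [h2, mul_assoc]
  have h3 := mesh_pos (π := π) (m + 1)
  have := key m
  gcongr

/-- Level `m` has at most `N(π^{m+1})` indices, since the middle points `t₂` are distinct. -/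
theorem card_I_le (h : π.Refining) (m : ℕ) : ((π.I m).card : ℝ) ≤ (π.minMesh (m + 1))⁻¹ := by
  have h1 : (π.I m).card ≤ π.N (m + 1) := by
    -- the position of `t₂` in the finer partition determines the index
    have := Finset.card_le_card_of_injOn (s := π.I m) (t := Finset.range (π.N (m + 1)))
      (fun κ => π.p m κ.1 + κ.2 - 1) ?_ ?_
    · simpa using this
    · intro κ hκ
      have h1 := index_le_N hκ
      have h2 := (mem_I.1 hκ).2.1
      simp only [Finset.coe_range, mem_Iio]
      omega
    · rintro ⟨k, i⟩ hκ ⟨k', i'⟩ hκ' heq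
      obtain ⟨h1, h2, h3⟩ := mem_I.1 hκ
      obtain ⟨h1', h2', h3'⟩ := mem_I.1 hκ'
      simp only at heq
      have hk : k = k' := by
        rcases lt_trichotomy k k' with hlt | rfl | hlt
        · have h4 : π.p m (k + 1) ≤ π.p m k' := by
            rcases (Nat.succ_le_of_lt hlt).lt_or_eq with h5 | h5
            · exact (p_lt_p h h5 h1'.le).le
            · rw [← h5]
          omega
        · rfl
        · have h4 : π.p m (k' + 1) ≤ π.p m k := by
            rcases (Nat.succ_le_of_lt hlt).lt_or_eq with h5 | h5
            · exact (p_lt_p h h5 h1.le).le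
            · rw [← h5]
          omega
      subst hk
      exact Prod.ext rfl (by simp only; omega)
  have h2 := N_mul_minMesh_le (π := π) (m + 1)
  rw [← one_div, le_div_iff₀ (minMesh_pos _)]
  refine le_trans ?_ h2
  have := minMesh_pos (π := π) (m + 1)
  gcongr

/-- The number of points of `π^{m+1}` in an interval of `π^m` is bounded. The level `m = 0`, to which
the hypotheses on the ratios of meshes do not apply, is covered by `N(π^1)`. -/
theorem exists_index_le (hbal : π.Balanced) (h : π.CompleteRefining) :
    ∃ K : ℕ, ∀ m, ∀ κ ∈ π.I m, κ.2 ≤ K := by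
  obtain ⟨c, hc, hbal⟩ := hbal
  obtain ⟨href, a, b, ha, hb, hab⟩ := h
  refine ⟨π.N 1 + ⌈b * c⌉₊, fun m κ hκ => ?_⟩
  obtain ⟨h1, h2, h3⟩ := mem_I.1 hκ
  have hN := index_le_N hκ
  rcases Nat.eq_zero_or_pos m with rfl | hm
  · have : π.N (0 + 1) = π.N 1 := rfl
    omega
  · have h4 := mul_minMesh_le hN
    have h5 : π.t (m + 1) (π.p m κ.1 + κ.2) - π.t (m + 1) (π.p m κ.1) ≤ π.mesh m := by
      refine le_trans ?_ (sub_le_mesh h1)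
      have := t₃_le href hκ
      have := t₁_eq href hκ
      simp only [t₁, t₃] at *
      linarith
    have h6 := (hab m hm).2
    have h7 := hbal (m + 1) (by omega)
    rw [div_le_iff₀ (mesh_pos _)] at h6
    rw [div_le_iff₀ (minMesh_pos _)] at h7
    have h8 : (κ.2 : ℝ) ≤ b * c := by
      refine le_of_mul_le_mul_right ?_ (minMesh_pos (π := π) (m + 1))
      calc (κ.2 : ℝ) * π.minMesh (m + 1) ≤ π.mesh m := h4.trans h5
        _ ≤ b * π.mesh (m + 1) := h6
        _ ≤ b * (c * π.minMesh (m + 1)) := by gcongr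
        _ = b * c * π.minMesh (m + 1) := by ring
    have h9 : κ.2 ≤ ⌈b * c⌉₊ := by exact_mod_cast h8.trans (Nat.le_ceil _)
    omega

/-! ### Schauder functions -/

section Schauder

variable {m : ℕ} {κ : ℕ × ℕ}

theorem e_eq_left {s : ℝ} (hs : s ∈ Ico (π.t₁ m κ) (π.t₂ m κ)) :
    π.e m κ s = √(π.Δ₂ m κ / π.Δ₁ m κ * (1 / (π.Δ₁ m κ + π.Δ₂ m κ))) * (s - π.t₁ m κ) :=
  if_pos hs

theorem e_eq_right {s : ℝ} (hs : s ∈ Icc (π.t₂ m κ) (π.t₃ m κ)) :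
    π.e m κ s = √(π.Δ₁ m κ / π.Δ₂ m κ * (1 / (π.Δ₁ m κ + π.Δ₂ m κ))) * (π.t₃ m κ - s) := by
  rw [e, if_neg (fun h => (h.2.trans_le hs.1).false)]
  split_ifs with h
  · rfl
  · have : s = π.t₃ m κ := le_antisymm hs.2 (not_lt.1 fun h' => h ⟨hs.1, h'⟩)
    rw [this, sub_self, mul_zero]

theorem e_eq_zero {s : ℝ} (hκ : κ ∈ π.I m) (hs : s ∉ Ioo (π.t₁ m κ) (π.t₃ m κ)) :
    π.e m κ s = 0 := by
  have h1 := Δ₁_pos hκ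
  have h2 := Δ₂_pos hκ
  rw [Δ₁] at h1
  rw [Δ₂] at h2
  rw [mem_Ioo, not_and_or, not_lt, not_lt] at hs
  rcases hs with hs | hs
  · rcases hs.lt_or_eq with hs | rfl
    · rw [e, if_neg (fun h => (hs.trans_le h.1).false),
        if_neg (fun h => by linarith [h.1])]
    · rw [e_eq_left ⟨le_rfl, by linarith⟩, sub_self, mul_zero]
  · rw [e, if_neg (fun h => by linarith [h.2]), if_neg (fun h => by linarith [h.2])]

/-- A Schauder function of level `m` vanishes at the points of `π^m`. -/
theorem e_eq_zero_of_mem_points (h : π.Refining) (hκ : κ ∈ π.I m) {s : ℝ}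
    (hs : s ∈ π.points m) : π.e m κ s = 0 := by
  obtain ⟨j, hj, rfl⟩ := hs
  refine e_eq_zero hκ ?_
  rintro ⟨h1, h2⟩
  have hk := (mem_I.1 hκ).1
  rw [t₁_eq h hκ] at h1
  have h3 := h2.trans_le (t₃_le h hκ)
  rcases le_or_gt j κ.1 with hjk | hjk
  · exact (h1.trans_le (t_le_t hjk hk.le)).false
  · exact (h3.trans_le (t_le_t hjk hj)).false

/-- The Schauder function as a truncated minimum of its two affine branches. -/
theorem e_eq_max_min (hκ : κ ∈ π.I m) (s : ℝ) :
    π.e m κ s = max 0 (min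
      (√(π.Δ₂ m κ / π.Δ₁ m κ * (1 / (π.Δ₁ m κ + π.Δ₂ m κ))) * (s - π.t₁ m κ))
      (√(π.Δ₁ m κ / π.Δ₂ m κ * (1 / (π.Δ₁ m κ + π.Δ₂ m κ))) * (π.t₃ m κ - s))) := by
  have h1 := Δ₁_pos hκ
  have h2 := Δ₂_pos hκ
  set a := √(π.Δ₂ m κ / π.Δ₁ m κ * (1 / (π.Δ₁ m κ + π.Δ₂ m κ))) with ha
  set b := √(π.Δ₁ m κ / π.Δ₂ m κ * (1 / (π.Δ₁ m κ + π.Δ₂ m κ))) with hb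
  have ha0 : 0 ≤ a := Real.sqrt_nonneg _
  have hb0 : 0 ≤ b := Real.sqrt_nonneg _
  -- both branches have the same value at `t₂`
  have hab : a * π.Δ₁ m κ = b * π.Δ₂ m κ := by
    rw [← sq_eq_sq₀ (by positivity) (by positivity), mul_pow, mul_pow, ha, hb,
      Real.sq_sqrt (by positivity), Real.sq_sqrt (by positivity)]
    field_simp
  have e1 : π.t₂ m κ = π.t₁ m κ + π.Δ₁ m κ := by rw [Δ₁]; ring
  have e2 : π.t₃ m κ = π.t₁ m κ + π.Δ₁ m κ + π.Δ₂ m κ := by rw [Δ₁, Δ₂]; ring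
  rcases lt_or_ge s (π.t₁ m κ) with hs1 | hs1
  · rw [e_eq_zero hκ (fun h => (h.1.trans hs1).false), max_eq_left]
    exact (min_le_left _ _).trans (mul_nonpos_of_nonneg_of_nonpos ha0 (by linarith))
  rcases lt_or_ge s (π.t₂ m κ) with hs2 | hs2
  · have h3 : a * (s - π.t₁ m κ) ≤ a * π.Δ₁ m κ := by gcongr; linarith
    have h4 : b * π.Δ₂ m κ ≤ b * (π.t₃ m κ - s) := by gcongr; linarith
    rw [e_eq_left ⟨hs1, hs2⟩, min_eq_left (by linarith), max_eq_right]
    exact mul_nonneg ha0 (by linarith)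
  rcases le_or_gt s (π.t₃ m κ) with hs3 | hs3
  · have h3 : a * π.Δ₁ m κ ≤ a * (s - π.t₁ m κ) := by gcongr; linarith
    have h4 : b * (π.t₃ m κ - s) ≤ b * π.Δ₂ m κ := by gcongr; linarith
    rw [e_eq_right ⟨hs2, hs3⟩, min_eq_right (by linarith), max_eq_right]
    exact mul_nonneg hb0 (by linarith)
  · rw [e_eq_zero hκ (fun h => (h.2.trans hs3).false), max_eq_left]
    exact (min_le_right _ _).trans (mul_nonpos_of_nonneg_of_nonpos hb0 (by linarith))

theorem e_nonneg (hκ : κ ∈ π.I m) (s : ℝ) : 0 ≤ π.e m κ s := by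
  rw [e_eq_max_min hκ]
  exact le_max_left _ _

/-- Slopes of a Schauder function are at most `minMesh ^ (-1/2)`. -/
theorem sqrt_slope_le {x y δ : ℝ} (hδ : 0 < δ) (hx : δ ≤ x) (hy : 0 < y) :
    √(y / x * (1 / (x + y))) ≤ √(δ⁻¹) := by
  have hx0 := hδ.trans_le hx
  apply Real.sqrt_le_sqrt
  calc y / x * (1 / (x + y)) = x⁻¹ * (y / (x + y)) := by field_simp
    _ ≤ δ⁻¹ * 1 := by
        gcongr
        exact (div_le_one (by positivity)).2 (by linarith)
    _ = δ⁻¹ := mul_one _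

theorem abs_e_sub_le (hκ : κ ∈ π.I m) (s t : ℝ) :
    |π.e m κ s - π.e m κ t| ≤ √((π.minMesh (m + 1))⁻¹) * |s - t| := by
  have h1 := Δ₁_pos hκ
  have h2 := Δ₂_pos hκ
  rw [e_eq_max_min hκ, e_eq_max_min hκ]
  refine (abs_max_sub_max_le_max _ _ _ _).trans ?_
  rw [sub_self, abs_zero]
  refine max_le (by positivity) ((abs_min_sub_min_le_max _ _ _ _).trans (max_le ?_ ?_))
  · rw [← mul_sub, sub_sub_sub_cancel_right, abs_mul, abs_of_nonneg (Real.sqrt_nonneg _)]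
    gcongr ?_ * _
    exact sqrt_slope_le (minMesh_pos _) (minMesh_le_Δ₁ hκ) h2
  · rw [← mul_sub, sub_sub_sub_cancel_left, abs_mul, abs_of_nonneg (Real.sqrt_nonneg _),
      abs_sub_comm t s]
    gcongr ?_ * _
    rw [add_comm (π.Δ₁ m κ)]
    exact sqrt_slope_le (minMesh_pos _) (minMesh_le_Δ₂ hκ) h1

theorem e_le_sqrt_mesh (hκ : κ ∈ π.I m) (s : ℝ) : π.e m κ s ≤ √(π.mesh (m + 1)) := by
  have h1 := Δ₁_pos hκ
  have h2 := Δ₂_pos hκ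
  by_cases hs : s ∈ Ioo (π.t₁ m κ) (π.t₃ m κ)
  swap
  · rw [e_eq_zero hκ hs]; exact Real.sqrt_nonneg _
  have e2 : π.t₃ m κ = π.t₂ m κ + π.Δ₂ m κ := by rw [Δ₂]; ring
  have e1 : π.t₂ m κ = π.t₁ m κ + π.Δ₁ m κ := by rw [Δ₁]; ring
  refine le_trans (b := √(π.Δ₂ m κ)) ?_ (Real.sqrt_le_sqrt (Δ₂_le_mesh hκ))
  refine Real.le_sqrt_of_sq_le ?_
  rcases lt_or_ge s (π.t₂ m κ) with hs2 | hs2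
  · rw [e_eq_left ⟨hs.1.le, hs2⟩, mul_pow, Real.sq_sqrt (by positivity)]
    have h3 : (s - π.t₁ m κ) ^ 2 ≤ π.Δ₁ m κ ^ 2 :=
      pow_le_pow_left₀ (by linarith [hs.1]) (by linarith) 2
    calc _ ≤ π.Δ₂ m κ / π.Δ₁ m κ * (1 / (π.Δ₁ m κ + π.Δ₂ m κ)) * π.Δ₁ m κ ^ 2 := by gcongr
      _ = π.Δ₂ m κ * (π.Δ₁ m κ / (π.Δ₁ m κ + π.Δ₂ m κ)) := by field_simp
      _ ≤ π.Δ₂ m κ * 1 := by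
        gcongr
        exact (div_le_one (by positivity)).2 (by linarith)
      _ = _ := mul_one _
  · rw [e_eq_right ⟨hs2, hs.2.le⟩, mul_pow, Real.sq_sqrt (by positivity)]
    have h3 : (π.t₃ m κ - s) ^ 2 ≤ π.Δ₂ m κ ^ 2 :=
      pow_le_pow_left₀ (by linarith [hs.2]) (by linarith) 2
    calc _ ≤ π.Δ₁ m κ / π.Δ₂ m κ * (1 / (π.Δ₁ m κ + π.Δ₂ m κ)) * π.Δ₂ m κ ^ 2 := by gcongr
      _ = π.Δ₂ m κ * (π.Δ₁ m κ / (π.Δ₁ m κ + π.Δ₂ m κ)) := by field_simp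
      _ ≤ π.Δ₂ m κ * 1 := by
        gcongr
        exact (div_le_one (by positivity)).2 (by linarith)
      _ = _ := mul_one _

theorem continuous_e (hκ : κ ∈ π.I m) : Continuous (π.e m κ) := by
  have : π.e m κ = fun s => _ := funext (e_eq_max_min hκ)
  rw [this]
  fun_prop

end Schauder

theorem continuous_schauderLevel (θ : ℕ → ℕ × ℕ → ℝ) (m : ℕ) :
    Continuous (π.schauderLevel θ m) :=
  continuous_finsetSum _ fun _ hκ => continuous_const.mul (continuous_e hκ)

theorem schauderLevel_eq_zero (h : π.Refining) (θ : ℕ → ℕ × ℕ → ℝ) {m : ℕ} {s : ℝ}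
    (hs : s ∈ π.points m) : π.schauderLevel θ m s = 0 :=
  Finset.sum_eq_zero fun _ hκ => by rw [e_eq_zero_of_mem_points h hκ hs, mul_zero]

/-- At a partition point the Schauder series is a finite sum. -/
theorem schauderSum_eq_sum (h : π.Refining) (θ : ℕ → ℕ × ℕ → ℝ) {n : ℕ} {s : ℝ}
    (hs : s ∈ π.points n) :
    π.schauderSum θ s = ∑ m ∈ Finset.range n, π.schauderLevel θ m s := by
  refine tsum_eq_sum fun m hm => schauderLevel_eq_zero h θ ?_
  exact points_mono h (by simpa using hm) hs

/-- At a given point at most `K` Schauder functions of each level are nonzero, when `K` bounds the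
second index. -/
theorem card_filter_e_ne_zero_le (h : π.Refining) {m K : ℕ} (hK : ∀ κ ∈ π.I m, κ.2 ≤ K) (s : ℝ) :
    ((π.I m).filter (fun κ => π.e m κ s ≠ 0)).card ≤ K := by
  have := Finset.card_le_card_of_injOn (s := (π.I m).filter (fun κ => π.e m κ s ≠ 0))
      (t := Finset.Icc 1 K) (fun κ => κ.2) ?_ ?_
  · simpa using this
  · intro κ hκ
    rw [Finset.mem_coe, Finset.mem_filter] at hκ
    have := (mem_I.1 hκ.1).2.1
    have := hK _ hκ.1
    simp only [Finset.coe_Icc, mem_Icc]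
    omega
  · intro κ hκ κ' hκ' heq
    rw [Finset.mem_coe, Finset.mem_filter] at hκ hκ'
    have key : ∀ κ, κ ∈ π.I m ∧ π.e m κ s ≠ 0 →
        κ.1 < π.N m ∧ π.t m κ.1 < s ∧ s < π.t m (κ.1 + 1) := by
      rintro κ ⟨h1, h2⟩
      have h3 : s ∈ Ioo (π.t₁ m κ) (π.t₃ m κ) := by
        by_contra hc
        exact h2 (e_eq_zero h1 hc)
      exact ⟨(mem_I.1 h1).1, t₁_eq h h1 ▸ h3.1, h3.2.trans_le (t₃_le h h1)⟩
    obtain ⟨a1, a2, a3⟩ := key _ hκ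
    obtain ⟨b1, b2, b3⟩ := key _ hκ'
    refine Prod.ext ?_ heq
    rcases lt_trichotomy κ.1 κ'.1 with hlt | he | hlt
    · exact absurd (a3.trans_le (t_le_t hlt b1.le)) b2.not_gt
    · exact he
    · exact absurd (b3.trans_le (t_le_t hlt a1.le)) a2.not_gt

/-! ### Schauder expansion as linear interpolation -/

/-- The affine function through `(a, x a)` and `(b, x b)`, evaluated at `s`. -/
noncomputable def linInterp (x : ℝ → ℝ) (a b s : ℝ) : ℝ := x a + (x b - x a) / (b - a) * (s - a)

theorem linInterp_left (x : ℝ → ℝ) (a b : ℝ) : linInterp x a b a = x a := by simp [linInterp]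

theorem linInterp_right (x : ℝ → ℝ) {a b : ℝ} (h : a < b) : linInterp x a b b = x b := by
  rw [linInterp, div_mul_cancel₀ _ (sub_pos.2 h).ne']
  ring

section Term

variable {m : ℕ} {κ : ℕ × ℕ}

theorem t₃_sub_t₁ : π.t₃ m κ - π.t₁ m κ = π.Δ₁ m κ + π.Δ₂ m κ := by
  rw [Δ₁, Δ₂]; ring

/-- On the left half of the support, a term of the Schauder expansion is the difference between the
interpolations before and after the removal of the middle point `t₂`. -/
theorem schauderCoeff_mul_e_left (x : ℝ → ℝ) (hκ : κ ∈ π.I m) {s : ℝ}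
    (hs : s ∈ Icc (π.t₁ m κ) (π.t₂ m κ)) :
    π.schauderCoeff x m κ * π.e m κ s =
      linInterp x (π.t₁ m κ) (π.t₂ m κ) s - linInterp x (π.t₁ m κ) (π.t₃ m κ) s := by
  have h1 := Δ₁_pos hκ
  have h2 := Δ₂_pos hκ
  have e0 : π.e m κ s =
      √(π.Δ₂ m κ / π.Δ₁ m κ * (1 / (π.Δ₁ m κ + π.Δ₂ m κ))) * (s - π.t₁ m κ) := by
    rcases hs.2.lt_or_eq with h | h
    · exact e_eq_left ⟨hs.1, h⟩
    · have h3 : s = π.t₁ m κ + π.Δ₁ m κ := by rw [h, Δ₁]; ring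
      have h4 : π.t₃ m κ - s = π.Δ₂ m κ := by rw [h, Δ₂]
      rw [e_eq_right ⟨h.ge, by linarith⟩, h4, h3, add_sub_cancel_left,
        ← sq_eq_sq₀ (by positivity) (by positivity), mul_pow, mul_pow,
        Real.sq_sqrt (by positivity), Real.sq_sqrt (by positivity)]
      field_simp
  have e3 : √(π.Δ₂ m κ / π.Δ₁ m κ * (1 / (π.Δ₁ m κ + π.Δ₂ m κ))) =
      √(π.Δ₁ m κ * π.Δ₂ m κ * (π.Δ₁ m κ + π.Δ₂ m κ)) / (π.Δ₁ m κ * (π.Δ₁ m κ + π.Δ₂ m κ)) := by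
    rw [eq_div_iff (by positivity), ← sq_eq_sq₀ (by positivity) (by positivity), mul_pow,
        Real.sq_sqrt (by positivity), Real.sq_sqrt (by positivity)]
    field_simp
  have e4 : √(π.Δ₁ m κ * π.Δ₂ m κ * (π.Δ₁ m κ + π.Δ₂ m κ)) ≠ 0 := by positivity
  have e5 : π.t₂ m κ - π.t₁ m κ = π.Δ₁ m κ := rfl
  rw [e0, e3, schauderCoeff, linInterp, linInterp, t₃_sub_t₁, e5]
  field_simp
  ring

theorem schauderCoeff_mul_e_right (x : ℝ → ℝ) (hκ : κ ∈ π.I m) {s : ℝ}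
    (hs : s ∈ Icc (π.t₂ m κ) (π.t₃ m κ)) :
    π.schauderCoeff x m κ * π.e m κ s =
      linInterp x (π.t₂ m κ) (π.t₃ m κ) s - linInterp x (π.t₁ m κ) (π.t₃ m κ) s := by
  have h1 := Δ₁_pos hκ
  have h2 := Δ₂_pos hκ
  have e3 : √(π.Δ₁ m κ / π.Δ₂ m κ * (1 / (π.Δ₁ m κ + π.Δ₂ m κ))) =
      √(π.Δ₁ m κ * π.Δ₂ m κ * (π.Δ₁ m κ + π.Δ₂ m κ)) / (π.Δ₂ m κ * (π.Δ₁ m κ + π.Δ₂ m κ)) := by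
    rw [eq_div_iff (by positivity), ← sq_eq_sq₀ (by positivity) (by positivity), mul_pow,
        Real.sq_sqrt (by positivity), Real.sq_sqrt (by positivity)]
    field_simp
  have e4 : √(π.Δ₁ m κ * π.Δ₂ m κ * (π.Δ₁ m κ + π.Δ₂ m κ)) ≠ 0 := by positivity
  have e5 : π.t₃ m κ - π.t₂ m κ = π.Δ₂ m κ := rfl
  rw [e_eq_right hs, e3, schauderCoeff, linInterp, linInterp, t₃_sub_t₁, e5]
  have e6 : π.t₃ m κ = π.t₁ m κ + π.Δ₁ m κ + π.Δ₂ m κ := by rw [Δ₁, Δ₂]; ring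
  have e7 : π.t₂ m κ = π.t₁ m κ + π.Δ₁ m κ := by rw [Δ₁]; ring
  generalize x (π.t₁ m κ) = x1
  generalize x (π.t₂ m κ) = x2
  generalize x (π.t₃ m κ) = x3
  rw [e6, e7]
  field_simp
  ring

end Term

/-- On an interval of `π^m`, only the Schauder functions attached to that interval contribute. -/
theorem schauderLevel_eq_sum_Icc (h : π.Refining) (θ : ℕ → ℕ × ℕ → ℝ) {m k : ℕ} (hk : k < π.N m)
    {s : ℝ} (hs : s ∈ Icc (π.t m k) (π.t m (k + 1))) :
    π.schauderLevel θ m s =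
      ∑ i ∈ Finset.Icc 2 (π.p m (k + 1) - π.p m k), θ m (k, i) * π.e m (k, i) s := by
  have hinj : Set.InjOn (fun i : ℕ => (k, i))
      (Finset.Icc 2 (π.p m (k + 1) - π.p m k) : Finset ℕ) := by
    intro a _ b _ hab
    exact (Prod.ext_iff.1 hab).2
  rw [schauderLevel, ← Finset.sum_image (g := fun i : ℕ => (k, i))
    (f := fun κ => θ m κ * π.e m κ s) hinj]
  symm
  refine Finset.sum_subset ?_ ?_
  · intro κ hκ
    obtain ⟨i, hi, rfl⟩ := Finset.mem_image.1 hκ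
    rw [Finset.mem_Icc] at hi
    exact mem_I.2 ⟨hk, hi.1, by omega⟩
  · rintro ⟨l, i⟩ hκ hn
    obtain ⟨h1, h2, h3⟩ := mem_I.1 hκ
    rw [e_eq_zero hκ, mul_zero]
    rintro ⟨h4, h5⟩
    rw [t₁_eq h hκ] at h4
    replace h5 := h5.trans_le (t₃_le h hκ)
    simp only at h4 h5
    rcases lt_trichotomy l k with hlt | rfl | hlt
    · exact absurd (hs.1.trans_lt h5) (t_le_t hlt hk.le).not_gt
    · exact hn (Finset.mem_image.2 ⟨i, Finset.mem_Icc.2 ⟨h2, by omega⟩, rfl⟩)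
    · exact absurd (h4.trans_le hs.2) (t_le_t hlt h1.le).not_gt

/-- One level of the Schauder expansion of `x` refines the interpolation along `π^m` to the one
along `π^{m+1}`. -/
theorem schauderLevel_schauderCoeff (h : π.Refining) (x : ℝ → ℝ) {m k j : ℕ} (hk : k < π.N m)
    (hj : j < π.p m (k + 1) - π.p m k) {s : ℝ}
    (hs : s ∈ Icc (π.t (m + 1) (π.p m k + j)) (π.t (m + 1) (π.p m k + j + 1))) :
    π.schauderLevel (π.schauderCoeff x) m s =
      linInterp x (π.t (m + 1) (π.p m k + j)) (π.t (m + 1) (π.p m k + j + 1)) s -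
        linInterp x (π.t m k) (π.t m (k + 1)) s := by
  have hpN := p_le (π := π) (m := m) (k := k + 1) hk
  have hmem : ∀ i, 2 ≤ i → i ≤ π.p m (k + 1) - π.p m k → (k, i) ∈ π.I m :=
    fun i h1 h2 => mem_I.2 ⟨hk, h1, by omega⟩
  have h1 : ∀ i, π.t₁ m (k, i) = π.t (m + 1) (π.p m k) := fun i => rfl
  have h2 : ∀ i, π.t₂ m (k, i) = π.t (m + 1) (π.p m k + i - 1) := fun i => rfl
  have h3 : ∀ i, π.t₃ m (k, i) = π.t (m + 1) (π.p m k + i) := fun i => rfl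
  -- removing the points of `π^{m+1}` one at a time, the sum telescopes
  have key : ∀ M, j + 1 ≤ M → M ≤ π.p m (k + 1) - π.p m k →
      ∑ i ∈ Finset.Icc 2 M, π.schauderCoeff x m (k, i) * π.e m (k, i) s =
        linInterp x (π.t (m + 1) (π.p m k + j)) (π.t (m + 1) (π.p m k + j + 1)) s -
          linInterp x (π.t (m + 1) (π.p m k)) (π.t (m + 1) (π.p m k + M)) s := by
    intro M hM
    induction M, hM using Nat.le_induction with
    | base =>
      intro hM
      rcases Nat.eq_zero_or_pos j with rfl | hj0
      · simp
      · rw [Finset.sum_Icc_succ_top (by omega), Finset.sum_eq_zero, zero_add,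
          schauderCoeff_mul_e_right x (hmem _ (by omega) hM), h1, h2, h3]
        · rfl
        · exact ⟨by rw [h2]; exact hs.1, by rw [h3]; exact hs.2⟩
        · intro i hi
          rw [Finset.mem_Icc] at hi
          rw [e_eq_zero (hmem i hi.1 (by omega)), mul_zero]
          rintro ⟨-, h5⟩
          rw [h3] at h5
          exact absurd (hs.1.trans_lt h5) (t_le_t (by omega) (by omega)).not_gt
    | succ M hM ih =>
      intro hM'
      rw [Finset.sum_Icc_succ_top (by omega), ih (by omega),
        schauderCoeff_mul_e_left x (hmem _ (by omega) hM'), h1, h2, h3]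
      · simp only [← add_assoc, Nat.add_sub_cancel]
        ring
      · rw [h1, h2]
        exact ⟨(t_le_t (by omega) (by omega)).trans hs.1,
          hs.2.trans (t_le_t (by omega) (by omega))⟩
  have hpk : π.p m k < π.p m (k + 1) := p_lt_p h (Nat.lt_add_one k) hk
  rw [schauderLevel_eq_sum_Icc h _ hk, key _ hj le_rfl, Nat.add_sub_cancel' hpk.le, t_p h hk.le,
    t_p h hk]
  rw [← t_p h hk.le, ← t_p h (k := k + 1) hk]
  exact ⟨(t_le_t (by omega) (by omega)).trans hs.1, hs.2.trans (t_le_t (by omega) (by omega))⟩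

/-- The Schauder expansion of `x` up to level `n`, together with its linear part, interpolates `x`
linearly along `π^n`. -/
theorem sum_schauderLevel_eq_linInterp (h : π.Refining) (x : ℝ → ℝ) (n : ℕ) :
    ∀ k < π.N n, ∀ s ∈ Icc (π.t n k) (π.t n (k + 1)),
      ∑ m ∈ Finset.range n, π.schauderLevel (π.schauderCoeff x) m s + linInterp x 0 1 s =
        linInterp x (π.t n k) (π.t n (k + 1)) s := by
  induction n with
  | zero =>
    intro k hk s _
    rw [π.N_zero] at hk
    obtain rfl : k = 0 := by omega
    have h1 := π.t_last 0
    rw [π.N_zero] at h1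
    simp [π.t_first, h1]
  | succ n ih =>
    intro l hl s hs
    -- the interval of `π^n` containing the `l`-th interval of `π^{n+1}`
    obtain ⟨k, hk, hk1, hk2⟩ : ∃ k < π.N n, π.p n k ≤ l ∧ l + 1 ≤ π.p n (k + 1) := by
      have key : ∀ K ≤ π.N n, l + 1 ≤ π.p n K →
          ∃ k < π.N n, π.p n k ≤ l ∧ l + 1 ≤ π.p n (k + 1) := by
        intro K
        induction K with
        | zero =>
          intro _ h1
          have : π.p n 0 = 0 := Nat.le_zero.1 (p_le_of_le (by rw [π.t_first, π.t_first]))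
          omega
        | succ K ihK =>
          intro hK h1
          rcases le_or_gt (π.p n K) l with h2 | h2
          · exact ⟨K, hK, h2, h1⟩
          · exact ihK (by omega) h2
      refine key _ le_rfl ?_
      by_contra! hc
      have h1 := t_p h (π := π) (m := n) le_rfl
      rw [π.t_last, ← π.t_last (n + 1)] at h1
      exact absurd h1 (t_lt_t (by omega) le_rfl).ne
    obtain ⟨j, rfl⟩ := Nat.exists_eq_add_of_le hk1
    have hpN := p_le (π := π) (m := n) (k := k + 1) hk
    have hs' : s ∈ Icc (π.t n k) (π.t n (k + 1)) := by
      rw [← t_p h hk.le, ← t_p h (k := k + 1) hk]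
      exact ⟨(t_le_t (by omega) (by omega)).trans hs.1,
        hs.2.trans (t_le_t (by omega) (by omega))⟩
    rw [Finset.sum_range_succ, schauderLevel_schauderCoeff h x hk (by omega) hs]
    linarith [ih k hk s hs']

/-- At the points of `π^n` the first `n` levels of the Schauder expansion recover `x` up to its
linear part. -/
theorem sum_schauderLevel_eq (h : π.Refining) (x : ℝ → ℝ) {n : ℕ} {s : ℝ} (hs : s ∈ π.points n) :
    ∑ m ∈ Finset.range n, π.schauderLevel (π.schauderCoeff x) m s =
      x s - x 0 - s * (x 1 - x 0) := by
  have key : ∑ m ∈ Finset.range n, π.schauderLevel (π.schauderCoeff x) m s + linInterp x 0 1 s =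
      x s := by
    obtain ⟨j, hj, rfl⟩ := hs
    rcases hj.lt_or_eq with hj' | rfl
    · rw [sum_schauderLevel_eq_linInterp h x n j hj' _ ⟨le_rfl, (π.t_lt n j hj').le⟩,
        linInterp_left]
    · obtain ⟨k, hk⟩ := Nat.exists_eq_succ_of_ne_zero (N_pos (π := π) n).ne'
      have hlt := π.t_lt n k (by omega)
      rw [hk, Nat.succ_eq_add_one,
        sum_schauderLevel_eq_linInterp h x n k (by omega) _ ⟨hlt.le, le_rfl⟩, linInterp_right x hlt]
  rw [linInterp, sub_zero, sub_zero, div_one] at key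
  linarith

end PartitionSeq

/-! ### Covariances at partition points -/

theorem fbmCov_comm (H s t : ℝ) : fbmCov H s t = fbmCov H t s := by
  rw [fbmCov, fbmCov, abs_sub_comm t s]; ring

theorem fbmCov_zero_right {H : ℝ} (hH : 0 < H) (s : ℝ) : fbmCov H s 0 = 0 := by
  rw [fbmCov, zero_sub, abs_neg, abs_zero, Real.zero_rpow (by positivity)]; ring

theorem fbmCov_zero_left {H : ℝ} (hH : 0 < H) (s : ℝ) : fbmCov H 0 s = 0 := by
  rw [fbmCov_comm, fbmCov_zero_right hH]

theorem fbmCov_self {H : ℝ} (hH : 0 < H) (s : ℝ) : fbmCov H s s = |s| ^ (2 * H) := by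
  rw [fbmCov, sub_self, abs_zero, Real.zero_rpow (by positivity)]; ring

theorem fbmIncCov_eq (H s t u v : ℝ) :
    fbmIncCov H s t u v = fbmCov H t v - fbmCov H t u - fbmCov H s v + fbmCov H s u := by
  simp only [fbmIncCov, fbmCov]
  rw [abs_sub_comm v t, abs_sub_comm u t, abs_sub_comm v s, abs_sub_comm u s]
  ring

namespace PartitionSeq

variable {π : PartitionSeq}

theorem schauderCoeff_sub_sub_mul (x y z : ℝ → ℝ) (c : ℝ) (m : ℕ) (κ : ℕ × ℕ) :
    π.schauderCoeff (fun u => x u - y u - c * (z u - y u)) m κ =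
      π.schauderCoeff x m κ - π.schauderCoeff y m κ -
        c * (π.schauderCoeff z m κ - π.schauderCoeff y m κ) := by
  simp only [schauderCoeff]
  ring

/-- `σ` is the fBM covariance, with the Schauder coefficient functional applied in both
variables. -/
theorem sigma_eq_schauderCoeff (H : ℝ) {m m' : ℕ} {κ κ' : ℕ × ℕ} (hκ : κ ∈ π.I m)
    (hκ' : κ' ∈ π.I m') :
    sigma π H m κ m' κ' =
      π.schauderCoeff (fun v => π.schauderCoeff (fun u => fbmCov H u v) m κ) m' κ' := by
  have h1 := Δ₁_pos hκ
  have h2 := Δ₂_pos hκ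
  have h1' := Δ₁_pos hκ'
  have h2' := Δ₂_pos hκ'
  have hs : √(π.Δ₁ m κ * π.Δ₂ m κ * π.Δ₁ m' κ' * π.Δ₂ m' κ' *
      (π.Δ₁ m κ + π.Δ₂ m κ) * (π.Δ₁ m' κ' + π.Δ₂ m' κ')) =
      √(π.Δ₁ m κ * π.Δ₂ m κ * (π.Δ₁ m κ + π.Δ₂ m κ)) *
        √(π.Δ₁ m' κ' * π.Δ₂ m' κ' * (π.Δ₁ m' κ' + π.Δ₂ m' κ')) := by
    rw [← Real.sqrt_mul (by positivity)]
    congr 1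
    ring
  have h3 : 0 < √(π.Δ₁ m κ * π.Δ₂ m κ * (π.Δ₁ m κ + π.Δ₂ m κ)) := by positivity
  have h3' : 0 < √(π.Δ₁ m' κ' * π.Δ₂ m' κ' * (π.Δ₁ m' κ' + π.Δ₂ m' κ')) := by positivity
  simp only [sigma, schauderCoeff, t₃_sub_t₁, hs, fbmIncCov_eq]
  generalize √(π.Δ₁ m κ * π.Δ₂ m κ * (π.Δ₁ m κ + π.Δ₂ m κ)) = r at *
  generalize √(π.Δ₁ m' κ' * π.Δ₂ m' κ' * (π.Δ₁ m' κ' + π.Δ₂ m' κ')) = r' at *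
  field_simp
  ring

theorem sigmaLin_eq_schauderCoeff {H : ℝ} (hH : 0 < H) (m : ℕ) (κ : ℕ × ℕ) :
    sigmaLin π H m κ = π.schauderCoeff (fun v => fbmCov H 1 v) m κ := by
  simp only [sigmaLin, schauderCoeff, t₃_sub_t₁, fbmIncCov_eq, fbmCov_zero_left hH]
  ring

theorem schauderLevel_congr {θ θ' : ℕ → ℕ × ℕ → ℝ} {m : ℕ}
    (h : ∀ κ ∈ π.I m, θ m κ = θ' m κ) (s : ℝ) :
    π.schauderLevel θ m s = π.schauderLevel θ' m s :=
  Finset.sum_congr rfl fun κ hκ => by rw [h κ hκ]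

section Moments

variable {Ω : Type*} [MeasurableSpace Ω] {P : Measure Ω} {θ : ℕ → ℕ × ℕ → Ω → ℝ}

theorem integral_mul_sum_schauderLevel {W : Ω → ℝ}
    (hint : ∀ m, ∀ κ ∈ π.I m, Integrable (fun ω => W ω * θ m κ ω) P) (n : ℕ) (t : ℝ) :
    ∫ ω, W ω * ∑ m ∈ Finset.range n, π.schauderLevel (fun m κ => θ m κ ω) m t ∂P =
      ∑ m ∈ Finset.range n, π.schauderLevel (fun m κ => ∫ ω, W ω * θ m κ ω ∂P) m t := by
  simp only [schauderLevel, Finset.mul_sum, ← mul_assoc]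
  rw [integral_finsetSum]
  · refine Finset.sum_congr rfl fun m _ => ?_
    rw [integral_finsetSum]
    · exact Finset.sum_congr rfl fun κ _ => integral_mul_const _ _
    · exact fun κ hκ => (hint m κ hκ).mul_const _
  · exact fun m _ => integrable_finsetSum _ fun κ hκ => (hint m κ hκ).mul_const _

theorem memLp_sum_schauderLevel (hθ : ∀ m, ∀ κ ∈ π.I m, MemLp (θ m κ) 2 P) (n : ℕ) (t : ℝ) :
    MemLp (fun ω => ∑ m ∈ Finset.range n, π.schauderLevel (fun m κ => θ m κ ω) m t) 2 P :=
  memLp_finsetSum _ fun m _ => memLp_finsetSum _ fun κ hκ => by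
    simpa only [mul_comm] using (hθ m κ hκ).const_mul (π.e m κ t)

variable {H : ℝ} {n : ℕ} {s t : ℝ}

theorem integral_sum_schauderLevel [IsFiniteMeasure P]
    (hθ : ∀ m, ∀ κ ∈ π.I m, MemLp (θ m κ) 2 P)
    (hmean : ∀ m, ∀ κ ∈ π.I m, ∫ ω, θ m κ ω ∂P = 0) (n : ℕ) (t : ℝ) :
    ∫ ω, ∑ m ∈ Finset.range n, π.schauderLevel (fun m κ => θ m κ ω) m t ∂P = 0 := by
  have h := integral_mul_sum_schauderLevel (π := π) (P := P) (θ := θ) (W := fun _ => 1)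
    (fun m κ hκ => by simpa using (hθ m κ hκ).integrable one_le_two) n t
  simp only [one_mul] at h
  rw [h]
  exact Finset.sum_eq_zero fun m _ => Finset.sum_eq_zero fun κ hκ =>
    mul_eq_zero_of_left (hmean m κ hκ) _

/-- At partition points, partial sums of the Schauder series have the covariance of
`B(t) - B(1) t`: by bilinearity the covariance is the Schauder expansion of the fBM covariance in
both variables. -/
theorem integral_sum_schauderLevel_mul (h : π.Refining) (hH : 0 < H)
    (hθ : ∀ m, ∀ κ ∈ π.I m, MemLp (θ m κ) 2 P)
    (hcov : ∀ m, ∀ κ ∈ π.I m, ∀ m', ∀ κ' ∈ π.I m',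
      ∫ ω, θ m κ ω * θ m' κ' ω ∂P = sigma π H m κ m' κ')
    (hs : s ∈ π.points n) (ht : t ∈ π.points n) :
    ∫ ω, (∑ m ∈ Finset.range n, π.schauderLevel (fun m κ => θ m κ ω) m t) *
        (∑ m ∈ Finset.range n, π.schauderLevel (fun m κ => θ m κ ω) m s) ∂P =
      fbmCov H t s - t * fbmCov H 1 s - s * fbmCov H t 1 + t * s := by
  have hcoef : ∀ m, ∀ κ ∈ π.I m,
      ∫ ω, (∑ m ∈ Finset.range n, π.schauderLevel (fun m κ => θ m κ ω) m s) * θ m κ ω ∂P =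
        π.schauderCoeff (fun u => fbmCov H u s - fbmCov H u 0 - s * (fbmCov H u 1 - fbmCov H u 0))
          m κ := by
    intro m κ hκ
    simp only [mul_comm _ (θ m κ _)]
    rw [integral_mul_sum_schauderLevel fun m' κ' hκ' => (hθ m κ hκ).integrable_mul (hθ m' κ' hκ'),
      schauderCoeff_sub_sub_mul, ← sum_schauderLevel_eq h
        (fun v => π.schauderCoeff (fun u => fbmCov H u v) m κ) hs]
    refine Finset.sum_congr rfl fun m' _ => schauderLevel_congr (fun κ' hκ' => ?_) _
    rw [hcov m κ hκ m' κ' hκ', sigma_eq_schauderCoeff H hκ hκ']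
  simp only [mul_comm (∑ m ∈ Finset.range n, π.schauderLevel (fun m κ => θ m κ _) m t)]
  rw [integral_mul_sum_schauderLevel fun m κ hκ =>
    (memLp_sum_schauderLevel hθ n s).integrable_mul (hθ m κ hκ)]
  rw [Finset.sum_congr rfl fun m _ => schauderLevel_congr (fun κ hκ => hcoef m κ hκ) _,
    sum_schauderLevel_eq h _ ht]
  simp only [fbmCov_zero_right hH, fbmCov_zero_left hH, fbmCov_self hH, abs_one, Real.one_rpow]
  ring

theorem integral_linear_mul_sum_schauderLevel (h : π.Refining) (hH : 0 < H) {Z : Ω → ℝ}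
    (hθ : ∀ m, ∀ κ ∈ π.I m, MemLp (θ m κ) 2 P) (hZ : MemLp Z 2 P)
    (hZcov : ∀ m, ∀ κ ∈ π.I m, ∫ ω, Z ω * θ m κ ω ∂P = sigmaLin π H m κ)
    (ht : t ∈ π.points n) :
    ∫ ω, Z ω * (∑ m ∈ Finset.range n, π.schauderLevel (fun m κ => θ m κ ω) m t) ∂P =
      fbmCov H 1 t - t := by
  rw [integral_mul_sum_schauderLevel fun m κ hκ => hZ.integrable_mul (hθ m κ hκ),
    Finset.sum_congr rfl fun m _ => schauderLevel_congr (fun κ hκ => by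
      rw [hZcov m κ hκ, sigmaLin_eq_schauderCoeff hH]) _, sum_schauderLevel_eq h _ ht]
  simp only [fbmCov_zero_right hH, fbmCov_self hH, abs_one, Real.one_rpow]
  ring

/-! ### Coefficients of a fractional Brownian motion -/

theorem integral_schauderCoeff_mul {X : ℝ → Ω → ℝ} {W : Ω → ℝ} {m : ℕ} {κ : ℕ × ℕ}
    (hκ : κ ∈ π.I m) (hint : ∀ t ∈ Icc (0 : ℝ) 1, Integrable (fun ω => X t ω * W ω) P) :
    ∫ ω, π.schauderCoeff (fun t => X t ω) m κ * W ω ∂P =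
      π.schauderCoeff (fun t => ∫ ω, X t ω * W ω ∂P) m κ := by
  have h1 := hint _ (t₁_mem_Icc hκ)
  have h2 := hint _ (t₂_mem_Icc hκ)
  have h3 := hint _ (t₃_mem_Icc hκ)
  have h21 : Integrable (fun ω => (X (π.t₂ m κ) ω * W ω - X (π.t₁ m κ) ω * W ω) * π.Δ₂ m κ) P :=
    (h2.sub h1).mul_const _
  have h32 : Integrable (fun ω => (X (π.t₃ m κ) ω * W ω - X (π.t₂ m κ) ω * W ω) * π.Δ₁ m κ) P :=
    (h3.sub h2).mul_const _
  simp only [schauderCoeff]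
  rw [← integral_sub h2 h1, ← integral_sub h3 h2, ← integral_mul_const, ← integral_mul_const,
    ← integral_sub h21 h32, ← integral_div]
  refine integral_congr_ae (Eventually.of_forall fun ω => ?_)
  simp only
  ring

theorem memLp_schauderCoeff {X : ℝ → Ω → ℝ} {m : ℕ} {κ : ℕ × ℕ}
    (hκ : κ ∈ π.I m) (hX : ∀ t ∈ Icc (0 : ℝ) 1, MemLp (X t) 2 P) :
    MemLp (fun ω => π.schauderCoeff (fun t => X t ω) m κ) 2 P := by
  have h1 := hX _ (t₁_mem_Icc hκ)
  have h2 := hX _ (t₂_mem_Icc hκ)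
  have h3 := hX _ (t₃_mem_Icc hκ)
  have := (((h2.sub h1).mul_const (π.Δ₂ m κ)).sub ((h3.sub h2).mul_const (π.Δ₁ m κ))).mul_const
    (√(π.Δ₁ m κ * π.Δ₂ m κ * (π.t₃ m κ - π.t₁ m κ)))⁻¹
  simpa only [schauderCoeff, div_eq_mul_inv, Pi.sub_apply] using this

end Moments

section FBM

variable {Ω : Type*} [MeasurableSpace Ω] {P : Measure Ω} {H : ℝ}
  {B : ℝ → Ω → ℝ}

theorem _root_.FakeFBM.IsFBM.memLp (hB : IsFBM H B P) {t : ℝ} (ht : t ∈ Icc (0 : ℝ) 1) :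
    MemLp (B t) 2 P :=
  (hB.gaussian.hasGaussianLaw_eval ⟨t, ht⟩).memLp_two

theorem _root_.FakeFBM.IsFBM.integral_schauderCoeff (hB : IsFBM H B P) {m : ℕ} {κ : ℕ × ℕ}
    (hκ : κ ∈ π.I m) : ∫ ω, π.schauderCoeff (fun t => B t ω) m κ ∂P = 0 := by
  have := hB.gaussian.isProbabilityMeasure
  have h := integral_schauderCoeff_mul (P := P) (X := B) (W := fun _ => 1) hκ
    (fun t ht => by simpa using (hB.memLp ht).integrable one_le_two)
  simp only [mul_one] at h
  rw [h, schauderCoeff, hB.mean _ (t₁_mem_Icc hκ), hB.mean _ (t₂_mem_Icc hκ),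
    hB.mean _ (t₃_mem_Icc hκ)]
  simp

theorem schauderCoeff_congr {x y : ℝ → ℝ} (h : ∀ t ∈ Icc (0 : ℝ) 1, x t = y t) {m : ℕ}
    {κ : ℕ × ℕ} (hκ : κ ∈ π.I m) : π.schauderCoeff x m κ = π.schauderCoeff y m κ := by
  rw [schauderCoeff, schauderCoeff, h _ (t₁_mem_Icc hκ), h _ (t₂_mem_Icc hκ),
    h _ (t₃_mem_Icc hκ)]

theorem _root_.FakeFBM.IsFBM.integral_schauderCoeff_mul (hB : IsFBM H B P) {m m' : ℕ}
    {κ κ' : ℕ × ℕ} (hκ : κ ∈ π.I m) (hκ' : κ' ∈ π.I m') :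
    ∫ ω, π.schauderCoeff (fun t => B t ω) m κ * π.schauderCoeff (fun t => B t ω) m' κ' ∂P =
      sigma π H m κ m' κ' := by
  have hB2 : ∀ t ∈ Icc (0 : ℝ) 1, MemLp (B t) 2 P := fun t ht => hB.memLp ht
  simp only [mul_comm (π.schauderCoeff _ m κ)]
  rw [PartitionSeq.integral_schauderCoeff_mul hκ'
    (fun t ht => (hB2 t ht).integrable_mul (memLp_schauderCoeff hκ hB2)),
    sigma_eq_schauderCoeff H hκ hκ']
  refine schauderCoeff_congr (fun v hv => ?_) hκ'
  simp only [mul_comm (B v _)]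
  rw [PartitionSeq.integral_schauderCoeff_mul hκ
    (fun t ht => (hB2 t ht).integrable_mul (hB2 v hv))]
  exact schauderCoeff_congr (fun u hu => hB.cov u hu v hv) hκ

theorem _root_.FakeFBM.IsFBM.integral_one_mul_schauderCoeff (hB : IsFBM H B P) (hH : 0 < H)
    {m : ℕ} {κ : ℕ × ℕ} (hκ : κ ∈ π.I m) :
    ∫ ω, B 1 ω * π.schauderCoeff (fun t => B t ω) m κ ∂P = sigmaLin π H m κ := by
  have h1 : (1 : ℝ) ∈ Icc (0 : ℝ) 1 := ⟨zero_le_one, le_rfl⟩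
  simp only [mul_comm (B 1 _)]
  rw [PartitionSeq.integral_schauderCoeff_mul hκ
    (fun t ht => (hB.memLp ht).integrable_mul (hB.memLp h1)), sigmaLin_eq_schauderCoeff hH]
  exact schauderCoeff_congr (fun u hu => by rw [hB.cov u hu 1 h1, fbmCov_comm]) hκ

end FBM

end PartitionSeq

/-! ### Almost sure bounds on the coefficients -/

section Tail

variable {Ω : Type*} [MeasurableSpace Ω] {P : Measure Ω} [IsProbabilityMeasure P]

/-- A random variable with a Gaussian tail is square integrable. -/
theorem memLp_two_of_tail {X : Ω → ℝ} (hX : Measurable X) {C₁ C₂ : ℝ} (hC₂ : 0 < C₂)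
    (htail : ∀ δ : ℝ, 0 < δ → P.real {ω | δ < |X ω|} ≤ C₁ * Real.exp (-(δ ^ 2 / (2 * C₂)))) :
    MemLp X 2 P := by
  rw [memLp_two_iff_integrable_sq hX.aestronglyMeasurable]
  refine ⟨(hX.pow_const 2).aestronglyMeasurable, ?_⟩
  rw [hasFiniteIntegral_iff_ofReal (Eventually.of_forall fun ω => sq_nonneg _)]
  have h1 : ∀ ω, X ω ^ 2 = |X ω| ^ (2 : ℝ) := fun ω => by
    rw [Real.rpow_two, sq_abs]
  simp only [h1]
  rw [lintegral_rpow_eq_lintegral_meas_lt_mul P (Eventually.of_forall fun ω => abs_nonneg _)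
    (by fun_prop) two_pos]
  refine ENNReal.mul_lt_top ENNReal.ofReal_lt_top ?_
  have hint : Integrable (fun t : ℝ => C₁ * (t * Real.exp (-(2 * C₂)⁻¹ * t ^ 2))) volume :=
    (integrable_mul_exp_neg_mul_sq (by positivity)).const_mul _
  refine lt_of_le_of_lt ?_ (hint.integrableOn (s := Ioi 0)).lintegral_lt_top
  refine setLIntegral_mono_ae' measurableSet_Ioi (Eventually.of_forall fun t (ht : 0 < t) => ?_)
  rw [← ofReal_measureReal, ← ENNReal.ofReal_mul measureReal_nonneg]
  refine ENNReal.ofReal_le_ofReal ?_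
  have h2 : (2 : ℝ) - 1 = 1 := by norm_num
  rw [h2, Real.rpow_one]
  calc _ ≤ C₁ * Real.exp (-(t ^ 2 / (2 * C₂))) * t := by
        gcongr
        exact htail t ht
    _ = _ := by
        have h3 : -(t ^ 2 / (2 * C₂)) = -(2 * C₂)⁻¹ * t ^ 2 := by ring
        rw [h3]
        ring

end Tail

theorem summable_pow_mul_exp_neg_sq {b c : ℝ} (hb : 0 < b) (hc : 0 < c) :
    Summable fun m : ℕ => b ^ m * Real.exp (-(((m : ℝ) + 1) ^ 2 / c)) := by
  refine summable_of_ratio_test_tendsto_lt_one (l := 0) one_pos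
    (Eventually.of_forall fun m => by positivity) ?_
  have h1 : ∀ m : ℕ, ‖b ^ (m + 1) * Real.exp (-((((m + 1 : ℕ) : ℝ) + 1) ^ 2 / c))‖ /
      ‖b ^ m * Real.exp (-(((m : ℝ) + 1) ^ 2 / c))‖ = b * Real.exp (-((2 * m + 3) / c)) := by
    intro m
    rw [Real.norm_of_nonneg (by positivity), Real.norm_of_nonneg (by positivity),
      div_eq_iff (by positivity), pow_succ]
    have h2 : -((((m + 1 : ℕ) : ℝ) + 1) ^ 2 / c) =
        -((2 * m + 3) / c) + -(((m : ℝ) + 1) ^ 2 / c) := by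
      push_cast; ring
    rw [h2, Real.exp_add]
    ring
  simp only [h1]
  rw [← mul_zero b]
  refine (Real.tendsto_exp_neg_atTop_nhds_zero.comp ?_).const_mul b
  refine Tendsto.atTop_div_const hc (tendsto_atTop_add_const_right _ _ ?_)
  exact tendsto_natCast_atTop_atTop.const_mul_atTop two_pos

namespace PartitionSeq

variable {π : PartitionSeq}

/-- By Borel–Cantelli, `|θ_{m,κ}| |π^{m+1}|^{1/2-H} ≤ m + 1` for all but finitely many `m`: the
number of indices of level `m` grows only geometrically. -/
theorem ae_exists_coeff_bound {Ω : Type*} [MeasurableSpace Ω] {P : Measure Ω}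
    [IsProbabilityMeasure P] {θ : ℕ → ℕ × ℕ → Ω → ℝ} (hbal : π.Balanced)
    (hcr : π.CompleteRefining) {C₁ C₂ β : ℝ} (hC₁ : 0 < C₁) (hC₂ : 0 < C₂)
    (htail : ∀ δ : ℝ, 0 < δ → ∀ m, ∀ κ ∈ π.I m,
      P.real {ω | δ < |θ m κ ω| * π.mesh (m + 1) ^ β} ≤ C₁ * Real.exp (-(δ ^ 2 / (2 * C₂)))) :
    ∀ᵐ ω ∂P, ∃ C : ℝ, ∀ m, ∀ κ ∈ π.I m, |θ m κ ω| * π.mesh (m + 1) ^ β ≤ C * (m + 1) := by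
  obtain ⟨b, C, hb, hC, hcard⟩ := exists_inv_minMesh_le hbal hcr
  let s : ℕ → Set Ω := fun m =>
    ⋃ κ ∈ π.I m, {ω | (m : ℝ) + 1 < |θ m κ ω| * π.mesh (m + 1) ^ β}
  have hs : ∀ m, P (s m) ≤
      ENNReal.ofReal (C * C₁ * (b ^ m * Real.exp (-(((m : ℝ) + 1) ^ 2 / (2 * C₂))))) := by
    intro m
    rw [← ofReal_measureReal (measure_ne_top P _)]
    refine ENNReal.ofReal_le_ofReal ?_
    calc P.real (s m)
        ≤ ∑ κ ∈ π.I m, P.real {ω | (m : ℝ) + 1 < |θ m κ ω| * π.mesh (m + 1) ^ β} :=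
          measureReal_biUnion_finset_le _ _
      _ ≤ ∑ κ ∈ π.I m, C₁ * Real.exp (-(((m : ℝ) + 1) ^ 2 / (2 * C₂))) :=
          Finset.sum_le_sum fun κ hκ => htail _ (by positivity) m κ hκ
      _ = (π.I m).card * (C₁ * Real.exp (-(((m : ℝ) + 1) ^ 2 / (2 * C₂)))) := by
          rw [Finset.sum_const, nsmul_eq_mul]
      _ ≤ C * b ^ m * (C₁ * Real.exp (-(((m : ℝ) + 1) ^ 2 / (2 * C₂)))) := by
          gcongr
          exact (card_I_le hcr.1 m).trans (hcard m)
      _ = _ := by ring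
  have hsum : ∑' m, P (s m) ≠ ⊤ := by
    refine ne_top_of_le_ne_top ?_ (ENNReal.tsum_le_tsum hs)
    exact ((summable_pow_mul_exp_neg_sq hb (by positivity)).mul_left _).tsum_ofReal_ne_top
  filter_upwards [ae_eventually_notMem hsum] with ω hω
  obtain ⟨M, hM⟩ := eventually_atTop.1 hω
  set F : ℕ → ℝ := fun m => ∑ κ ∈ π.I m, |θ m κ ω| * π.mesh (m + 1) ^ β with hF
  have hpos : ∀ m κ, 0 ≤ |θ m κ ω| * π.mesh (m + 1) ^ β := fun m κ =>
    mul_nonneg (abs_nonneg _) (Real.rpow_nonneg (mesh_pos _).le _)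
  have hFpos : ∀ m, 0 ≤ F m := fun m => Finset.sum_nonneg fun κ _ => hpos m κ
  refine ⟨1 + ∑ m ∈ Finset.range M, F m, fun m κ hκ => ?_⟩
  have h0 : 0 ≤ ∑ m ∈ Finset.range M, F m := Finset.sum_nonneg fun m _ => hFpos m
  rcases le_or_gt M m with hm | hm
  · have h1 := hM m hm
    simp only [s, mem_iUnion, not_exists] at h1
    have h2 : |θ m κ ω| * π.mesh (m + 1) ^ β ≤ m + 1 := not_lt.1 (h1 κ hκ)
    nlinarith
  · have h1 : |θ m κ ω| * π.mesh (m + 1) ^ β ≤ F m :=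
      Finset.single_le_sum (f := fun κ => |θ m κ ω| * π.mesh (m + 1) ^ β)
        (fun κ _ => hpos m κ) hκ
    have h2 : F m ≤ ∑ m ∈ Finset.range M, F m :=
      Finset.single_le_sum (fun m _ => hFpos m) (Finset.mem_range.2 hm)
    have h3 : (0 : ℝ) ≤ m := Nat.cast_nonneg m
    nlinarith

/-! ### Hölder regularity of Schauder series -/

theorem le_rpow_mul_rpow {d x y α : ℝ} (hd : 0 ≤ d) (hx : d ≤ x) (hy : d ≤ y) (hα : 0 ≤ α)
    (hα1 : α ≤ 1) : d ≤ x ^ (1 - α) * y ^ α := by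
  calc d = d ^ (1 - α) * d ^ α := by
        rw [← Real.rpow_add_of_nonneg hd (by linarith) hα, sub_add_cancel, Real.rpow_one]
    _ ≤ x ^ (1 - α) * y ^ α :=
        mul_le_mul (Real.rpow_le_rpow hd hx (by linarith)) (Real.rpow_le_rpow hd hy hα)
          (Real.rpow_nonneg hd _) (Real.rpow_nonneg (hd.trans hx) _)

/-- Interpolation between the sup bound and the Lipschitz bound of a Schauder function. -/
theorem abs_e_sub_le_rpow {c : ℝ} {m : ℕ} (hc : π.mesh (m + 1) / π.minMesh (m + 1) ≤ c)
    {κ : ℕ × ℕ} (hκ : κ ∈ π.I m) {α : ℝ} (hα : 0 ≤ α) (hα1 : α ≤ 1) (s t : ℝ) :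
    |π.e m κ s - π.e m κ t| ≤ √c ^ α * π.mesh (m + 1) ^ (1 / 2 - α) * |s - t| ^ α := by
  have hμ := mesh_pos (π := π) (m + 1)
  have hμ' := minMesh_pos (π := π) (m + 1)
  have hc0 : 0 ≤ c := (div_nonneg hμ.le hμ'.le).trans hc
  have h1 : |π.e m κ s - π.e m κ t| ≤ √(π.mesh (m + 1)) := by
    rw [abs_sub_le_iff]
    have := e_nonneg hκ s
    have := e_nonneg hκ t
    have := e_le_sqrt_mesh hκ s
    have := e_le_sqrt_mesh hκ t
    constructor <;> linarith
  have h2 : |π.e m κ s - π.e m κ t| ≤ √c * π.mesh (m + 1) ^ (-(1 / 2) : ℝ) * |s - t| := by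
    refine (abs_e_sub_le hκ s t).trans ?_
    gcongr
    rw [Real.rpow_neg hμ.le, ← Real.sqrt_eq_rpow, ← div_eq_mul_inv, ← Real.sqrt_div' _ hμ.le]
    refine Real.sqrt_le_sqrt ?_
    rw [le_div_iff₀ hμ, mul_comm, ← div_eq_mul_inv]
    exact hc
  refine (le_rpow_mul_rpow (abs_nonneg _) h1 h2 hα hα1).trans (le_of_eq ?_)
  rw [Real.mul_rpow (by positivity) (abs_nonneg _), Real.mul_rpow (by positivity) (by positivity),
    ← Real.rpow_mul hμ.le, Real.sqrt_eq_rpow (π.mesh _), ← Real.rpow_mul hμ.le]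
  have h3 : (1 / 2 - α : ℝ) = 1 / 2 * (1 - α) + -(1 / 2) * α := by ring
  rw [h3, Real.rpow_add hμ]
  ring

/-- Hölder bound for one level of a Schauder series. -/
theorem abs_schauderLevel_sub_le (h : π.Refining) {c : ℝ} {m K : ℕ}
    (hc : π.mesh (m + 1) / π.minMesh (m + 1) ≤ c) (hK : ∀ κ ∈ π.I m, κ.2 ≤ K)
    {θ : ℕ → ℕ × ℕ → ℝ} {H D : ℝ} (hD : 0 ≤ D)
    (hθ : ∀ κ ∈ π.I m, |θ m κ| * π.mesh (m + 1) ^ (1 / 2 - H) ≤ D)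
    {α : ℝ} (hα : 0 ≤ α) (hα1 : α ≤ 1) (s t : ℝ) :
    |π.schauderLevel θ m s - π.schauderLevel θ m t| ≤
      2 * K * (D * √c ^ α * π.mesh (m + 1) ^ (H - α)) * |s - t| ^ α := by
  have hμ := mesh_pos (π := π) (m + 1)
  set B := D * √c ^ α * π.mesh (m + 1) ^ (H - α) * |s - t| ^ α with hB
  have hB0 : 0 ≤ B := by positivity
  have hterm : ∀ κ ∈ π.I m, |θ m κ * π.e m κ s - θ m κ * π.e m κ t| ≤ B := by
    intro κ hκ
    rw [← mul_sub, abs_mul]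
    have h1 : π.mesh (m + 1) ^ (1 / 2 - α) =
        π.mesh (m + 1) ^ (1 / 2 - H) * π.mesh (m + 1) ^ (H - α) := by
      rw [← Real.rpow_add hμ]
      congr 1
      ring
    calc |θ m κ| * |π.e m κ s - π.e m κ t|
        ≤ |θ m κ| * (√c ^ α * π.mesh (m + 1) ^ (1 / 2 - α) * |s - t| ^ α) := by
          gcongr
          exact abs_e_sub_le_rpow hc hκ hα hα1 s t
      _ = |θ m κ| * π.mesh (m + 1) ^ (1 / 2 - H) *
            (√c ^ α * π.mesh (m + 1) ^ (H - α) * |s - t| ^ α) := by rw [h1]; ring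
      _ ≤ D * (√c ^ α * π.mesh (m + 1) ^ (H - α) * |s - t| ^ α) := by
          gcongr
          exact hθ κ hκ
      _ = B := by rw [hB]; ring
  -- only functions that do not vanish at both `s` and `t` contribute
  set J := (π.I m).filter (fun κ => π.e m κ s ≠ 0) ∪ (π.I m).filter (fun κ => π.e m κ t ≠ 0)
    with hJ
  have hcard : (J.card : ℝ) ≤ 2 * K := by
    have h1 := Finset.card_union_le ((π.I m).filter (fun κ => π.e m κ s ≠ 0))
      ((π.I m).filter (fun κ => π.e m κ t ≠ 0))
    have h2 := card_filter_e_ne_zero_le h hK s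
    have h3 := card_filter_e_ne_zero_le h hK t
    have h4 : J.card ≤ 2 * K := by rw [hJ]; omega
    exact_mod_cast h4
  have hJI : J ⊆ π.I m := Finset.union_subset (Finset.filter_subset _ _) (Finset.filter_subset _ _)
  calc |π.schauderLevel θ m s - π.schauderLevel θ m t|
      ≤ ∑ κ ∈ π.I m, |θ m κ * π.e m κ s - θ m κ * π.e m κ t| := by
        rw [schauderLevel, schauderLevel, ← Finset.sum_sub_distrib]
        exact Finset.abs_sum_le_sum_abs _ _
    _ = ∑ κ ∈ J, |θ m κ * π.e m κ s - θ m κ * π.e m κ t| := by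
        refine (Finset.sum_subset hJI fun κ hκ hn => ?_).symm
        simp only [hJ, Finset.mem_union, Finset.mem_filter, not_or, not_and, not_not] at hn
        rw [hn.1 hκ, hn.2 hκ, sub_self, abs_zero]
    _ ≤ ∑ κ ∈ J, B := Finset.sum_le_sum fun κ hκ => hterm κ (hJI hκ)
    _ = J.card * B := by rw [Finset.sum_const, nsmul_eq_mul]
    _ ≤ 2 * K * B := by gcongr
    _ = _ := by rw [hB]; ring

/-- If `|θ_{m,κ}| |π^{m+1}|^{1/2-H} ≤ C (m + 1)`, the `α`-Hölder constants of the levels of the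
Schauder series are summable for `α < H`. -/
theorem exists_summable_holder_bound (hbal : π.Balanced) (hcr : π.CompleteRefining)
    {θ : ℕ → ℕ × ℕ → ℝ} {H C : ℝ} (hH1 : H ≤ 1)
    (hθ : ∀ m, ∀ κ ∈ π.I m, |θ m κ| * π.mesh (m + 1) ^ (1 / 2 - H) ≤ C * (m + 1))
    {α : ℝ} (hα : 0 ≤ α) (hαH : α < H) :
    ∃ u : ℕ → ℝ, Summable u ∧ ∀ m s t,
      |π.schauderLevel θ m s - π.schauderLevel θ m t| ≤ u m * |s - t| ^ α := by
  obtain ⟨K, hK⟩ := exists_index_le hbal hcr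
  obtain ⟨q, A, hq0, hq1, hA, hmesh⟩ := hcr.exists_mesh_le
  obtain ⟨c, hc1, hc⟩ := hbal
  have hr0 : 0 ≤ q ^ (H - α) := Real.rpow_nonneg hq0.le _
  have hr1 : q ^ (H - α) < 1 := Real.rpow_lt_one hq0.le hq1 (by linarith)
  refine ⟨fun m => 2 * K * (|C| * √c ^ α * A ^ (H - α)) * (((m : ℝ) + 1) * (q ^ (H - α)) ^ m), ?_,
    fun m s t => ?_⟩
  · refine Summable.mul_left _ ?_
    have h1 : Summable fun m : ℕ => (m : ℝ) ^ 1 * (q ^ (H - α)) ^ m :=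
      summable_pow_mul_geometric_of_norm_lt_one 1 (by rwa [Real.norm_of_nonneg hr0])
    have h2 := summable_geometric_of_lt_one hr0 hr1
    refine (h1.add h2).congr fun m => ?_
    ring
  · have h0 : ∀ κ ∈ π.I m, |θ m κ| * π.mesh (m + 1) ^ (1 / 2 - H) ≤ |C| * (m + 1) :=
      fun κ hκ => (hθ m κ hκ).trans (by gcongr; exact le_abs_self C)
    refine (abs_schauderLevel_sub_le hcr.1 (hc (m + 1) (by omega)) (hK m) (by positivity) h0 hα
      (by linarith) s t).trans ?_
    have h1 : π.mesh (m + 1) ^ (H - α) ≤ A ^ (H - α) * (q ^ (H - α)) ^ m := by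
      calc π.mesh (m + 1) ^ (H - α) ≤ (A * q ^ m) ^ (H - α) :=
            Real.rpow_le_rpow (mesh_pos _).le (hmesh m) (by linarith)
        _ = A ^ (H - α) * (q ^ (H - α)) ^ m := by
            rw [Real.mul_rpow hA.le (by positivity), ← Real.rpow_natCast, ← Real.rpow_natCast,
              ← Real.rpow_mul hq0.le, ← Real.rpow_mul hq0.le, mul_comm (m : ℝ)]
    calc _ ≤ 2 * K * (|C| * (m + 1) * √c ^ α * (A ^ (H - α) * (q ^ (H - α)) ^ m)) *
          |s - t| ^ α := by gcongr
      _ = _ := by ring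

section Series

variable {θ : ℕ → ℕ × ℕ → ℝ} {H C : ℝ}

theorem tendstoUniformlyOn_schauderSum (hbal : π.Balanced) (hcr : π.CompleteRefining)
    (hH : 0 < H) (hH1 : H ≤ 1)
    (hθ : ∀ m, ∀ κ ∈ π.I m, |θ m κ| * π.mesh (m + 1) ^ (1 / 2 - H) ≤ C * (m + 1)) :
    TendstoUniformlyOn (fun n t => ∑ m ∈ Finset.range (n + 1), π.schauderLevel θ m t)
      (π.schauderSum θ) atTop (Icc 0 1) := by
  -- every level vanishes at `0`, so the bound of order `0` is a bound of the sup norm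
  obtain ⟨u, hu, hbound⟩ := exists_summable_holder_bound hbal hcr hH1 hθ le_rfl hH
  have h0 : ∀ m, π.schauderLevel θ m 0 = 0 := fun m =>
    schauderLevel_eq_zero hcr.1 θ ⟨0, Nat.zero_le _, (π.t_first m).symm⟩
  have h1 := tendstoUniformlyOn_tsum_nat hu (s := Icc (0 : ℝ) 1) (f := π.schauderLevel θ)
    (fun m s _ => by simpa [h0] using hbound m s 0)
  exact fun v hv => (tendsto_add_atTop_nat 1).eventually (h1 v hv)

/-- Schauder series whose coefficients satisfy `|θ_{m,κ}| |π^{m+1}|^{1/2-H} ≤ C (m + 1)` belong to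
`C^{H-}`. -/
theorem inHolderMinus_schauderSum (hbal : π.Balanced) (hcr : π.CompleteRefining)
    (hH : 0 < H) (hH1 : H ≤ 1)
    (hθ : ∀ m, ∀ κ ∈ π.I m, |θ m κ| * π.mesh (m + 1) ^ (1 / 2 - H) ≤ C * (m + 1)) :
    InHolderMinus H (π.schauderSum θ) := by
  have hunif := tendstoUniformlyOn_schauderSum hbal hcr hH hH1 hθ
  refine ⟨hunif.continuousOn (Eventually.of_forall fun n => Continuous.continuousOn
    (continuous_finsetSum _ fun m _ => continuous_schauderLevel θ m)).frequently, fun α hα => ?_⟩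
  obtain ⟨u, hu, hbound⟩ := exists_summable_holder_bound hbal hcr hH1 hθ α.2 hα
  have hu0 : ∀ m, 0 ≤ u m := fun m => by
    have := (abs_nonneg _).trans (hbound m 1 0)
    simpa using this
  have hlim : ∀ s ∈ Icc (0 : ℝ) 1,
      Tendsto (fun n => ∑ m ∈ Finset.range (n + 1), π.schauderLevel θ m s) atTop
        (𝓝 (π.schauderSum θ s)) := fun s hs => hunif.tendsto_at hs
  refine ⟨(∑' m, u m).toNNReal, fun s hs t ht => ?_⟩
  have hle : |π.schauderSum θ s - π.schauderSum θ t| ≤ (∑' m, u m) * |s - t| ^ (α : ℝ) := by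
    refine le_of_tendsto ((hlim s hs).sub (hlim t ht)).abs (Eventually.of_forall fun n => ?_)
    rw [← Finset.sum_sub_distrib]
    refine (Finset.abs_sum_le_sum_abs _ _).trans
      ((Finset.sum_le_sum fun m _ => hbound m s t).trans ?_)
    rw [← Finset.sum_mul]
    exact mul_le_mul_of_nonneg_right (hu.sum_le_tsum _ fun m _ => hu0 m)
      (Real.rpow_nonneg (abs_nonneg _) _)
  rw [edist_dist, edist_dist, Real.dist_eq, Real.dist_eq,
    ENNReal.ofReal_rpow_of_nonneg (abs_nonneg (s - t)) α.coe_nonneg, ← ENNReal.ofReal,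
    ← ENNReal.ofReal_mul (tsum_nonneg hu0)]
  exact ENNReal.ofReal_le_ofReal hle

end Series

end PartitionSeq

/-! ### Limits in `L²` -/

section L2

variable {Ω : Type*} [MeasurableSpace Ω] {P : Measure Ω}

theorem inner_toLp {f g : Ω → ℝ} (hf : MemLp f 2 P) (hg : MemLp g 2 P) :
    inner ℝ (hf.toLp f) (hg.toLp g) = ∫ ω, f ω * g ω ∂P := by
  rw [L2.inner_def]
  refine integral_congr_ae ?_
  filter_upwards [hf.coeFn_toLp, hg.coeFn_toLp] with ω h1 h2
  rw [h1, h2, real_inner_eq_re_inner, RCLike.inner_apply]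
  simp [mul_comm]

theorem tendsto_integral_mul {X Y : ℕ → Ω → ℝ} {x y : Ω → ℝ} {hX : ∀ n, MemLp (X n) 2 P}
    {hY : ∀ n, MemLp (Y n) 2 P} {hx : MemLp x 2 P} {hy : MemLp y 2 P}
    (h1 : Tendsto (fun n => (hX n).toLp (X n)) atTop (𝓝 (hx.toLp x)))
    (h2 : Tendsto (fun n => (hY n).toLp (Y n)) atTop (𝓝 (hy.toLp y))) :
    Tendsto (fun n => ∫ ω, X n ω * Y n ω ∂P) atTop (𝓝 (∫ ω, x ω * y ω ∂P)) := by
  simpa only [inner_toLp] using h1.inner (𝕜 := ℝ) h2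

/-- An almost sure limit of a sequence whose second moments `E[X_j X_l]` converge is a limit in
`L²`. -/
theorem exists_tendsto_toLp {X : ℕ → Ω → ℝ} {x : Ω → ℝ} (hX : ∀ n, MemLp (X n) 2 P)
    (hlim : ∀ᵐ ω ∂P, Tendsto (fun n => X n ω) atTop (𝓝 (x ω))) {c : ℝ}
    (hc : Tendsto (fun p : ℕ × ℕ => ∫ ω, X p.1 ω * X p.2 ω ∂P) atTop (𝓝 c)) :
    ∃ hx : MemLp x 2 P, Tendsto (fun n => (hX n).toLp (X n)) atTop (𝓝 (hx.toLp x)) := by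
  set F : ℕ → Lp ℝ 2 P := fun n => (hX n).toLp (X n) with hF
  have hcF : Tendsto (fun p : ℕ × ℕ => inner ℝ (F p.1) (F p.2)) atTop (𝓝 c) := by
    simpa only [hF, inner_toLp] using hc
  have hfst : Tendsto (fun p : ℕ × ℕ => (p.1, p.1)) atTop atTop := by
    rw [← prod_atTop_atTop_eq]
    exact tendsto_fst.prodMk tendsto_fst
  have hsnd : Tendsto (fun p : ℕ × ℕ => (p.2, p.2)) atTop atTop := by
    rw [← prod_atTop_atTop_eq]
    exact tendsto_snd.prodMk tendsto_snd
  have hcauchy : CauchySeq F := by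
    rw [cauchySeq_iff_tendsto_dist_atTop_0]
    have h1 := ((hcF.comp hfst).sub (hcF.const_mul 2)).add (hcF.comp hsnd)
    have h2 : c - 2 * c + c = 0 := by ring
    rw [h2] at h1
    have h3 := h1.sqrt
    rw [Real.sqrt_zero] at h3
    refine h3.congr fun p => ?_
    rw [dist_eq_norm, ← Real.sqrt_sq (norm_nonneg (F p.1 - F p.2)), norm_sub_sq_real]
    simp only [Function.comp, real_inner_self_eq_norm_sq]
  obtain ⟨G, hG⟩ := cauchySeq_tendsto_of_complete hcauchy
  obtain ⟨φ, hφ, hφG⟩ := (tendstoInMeasure_of_tendsto_Lp hG).exists_seq_tendsto_ae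
  have hxG : G =ᵐ[P] x := by
    have hall : ∀ᵐ ω ∂P, ∀ n, F n ω = X n ω := ae_all_iff.2 fun n => (hX n).coeFn_toLp
    filter_upwards [hφG, hlim, hall] with ω h1 h2 h3
    simp only [h3] at h1
    exact tendsto_nhds_unique h1 (h2.comp hφ.tendsto_atTop)
  have hx : MemLp x 2 P := (Lp.memLp G).ae_eq hxG
  refine ⟨hx, ?_⟩
  have : hx.toLp x = G := Lp.ext (hx.coeFn_toLp.trans hxG.symm)
  rwa [this]

end L2

theorem tendsto_fbmCov {ι : Type*} {l : Filter ι} {H : ℝ} (hH : 0 < H) {f g : ι → ℝ} {a b : ℝ}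
    (hf : Tendsto f l (𝓝 a)) (hg : Tendsto g l (𝓝 b)) :
    Tendsto (fun i => fbmCov H (f i) (g i)) l (𝓝 (fbmCov H a b)) := by
  have h : ∀ {f : ι → ℝ} {a : ℝ}, Tendsto f l (𝓝 a) →
      Tendsto (fun i => |f i| ^ (2 * H)) l (𝓝 (|a| ^ (2 * H))) := fun hf =>
    hf.abs.rpow_const (Or.inr (by positivity))
  simp only [fbmCov]
  exact (((h hf).add (h hg)).sub (h (hg.sub hf))).div_const 2

theorem tendsto_bridgeCov {ι : Type*} {l : Filter ι} {H : ℝ} (hH : 0 < H) {f g : ι → ℝ} {a b : ℝ}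
    (hf : Tendsto f l (𝓝 a)) (hg : Tendsto g l (𝓝 b)) :
    Tendsto (fun i => fbmCov H (f i) (g i) - f i * fbmCov H 1 (g i) - g i * fbmCov H (f i) 1 +
      f i * g i) l (𝓝 (fbmCov H a b - a * fbmCov H 1 b - b * fbmCov H a 1 + a * b)) :=
  (((tendsto_fbmCov hH hf hg).sub (hf.mul (tendsto_fbmCov hH tendsto_const_nhds hg))).sub
    (hg.mul (tendsto_fbmCov hH hf tendsto_const_nhds))).add (hf.mul hg)

namespace PartitionSeq

variable {π : PartitionSeq}

theorem CompleteRefining.tendsto_mesh (h : π.CompleteRefining) :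
    Tendsto π.mesh atTop (𝓝 0) := by
  obtain ⟨q, C, hq0, hq1, -, hle⟩ := h.exists_mesh_le
  rw [← tendsto_add_atTop_iff_nat 1]
  refine squeeze_zero (fun m => (mesh_pos _).le) hle ?_
  simpa using (tendsto_pow_atTop_nhds_zero_of_lt_one hq0.le hq1).const_mul C

theorem exists_tendsto_points (h : π.CompleteRefining) {t : ℝ} (ht : t ∈ Icc (0 : ℝ) 1) :
    ∃ τ : ℕ → ℝ, (∀ n, τ n ∈ π.points n) ∧ Tendsto τ atTop (𝓝 t) := by
  choose k hk hkt using fun n => exists_mem_Icc_t (π := π) n ht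
  refine ⟨fun n => π.t n (k n), fun n => ⟨k n, (hk n).le, rfl⟩, ?_⟩
  rw [tendsto_iff_dist_tendsto_zero]
  refine squeeze_zero (fun n => dist_nonneg) (fun n => ?_) h.tendsto_mesh
  have h1 := sub_le_mesh (hk n)
  have h2 := hkt n
  rw [Real.dist_eq, abs_sub_comm, abs_of_nonneg (sub_nonneg.2 h2.1)]
  linarith [h2.2]

/-! ### Moments of the Schauder series -/

section Moments

variable {Ω : Type*} [MeasurableSpace Ω] {P : Measure Ω} {θ : ℕ → ℕ × ℕ → Ω → ℝ} {H s t : ℝ}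

/-- The value of the Schauder series at any point is the `L²`-limit of its values at partition
points: it is an almost sure limit by continuity of the paths, and the covariances at partition
points are given by a continuous kernel. -/
theorem exists_tendsto_toLp_schauderSum (hcr : π.CompleteRefining) (hH : 0 < H)
    (hθ : ∀ m, ∀ κ ∈ π.I m, MemLp (θ m κ) 2 P)
    (hcov : ∀ m, ∀ κ ∈ π.I m, ∀ m', ∀ κ' ∈ π.I m',
      ∫ ω, θ m κ ω * θ m' κ' ω ∂P = sigma π H m κ m' κ')
    (hcont : ∀ᵐ ω ∂P, ContinuousOn (π.schauderSum fun m κ => θ m κ ω) (Icc 0 1))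
    (ht : t ∈ Icc (0 : ℝ) 1) :
    ∃ τ : ℕ → ℝ, (∀ n, τ n ∈ π.points n) ∧ Tendsto τ atTop (𝓝 t) ∧
      ∃ (hX : ∀ n, MemLp (fun ω => π.schauderSum (fun m κ => θ m κ ω) (τ n)) 2 P)
        (hx : MemLp (fun ω => π.schauderSum (fun m κ => θ m κ ω) t) 2 P),
        Tendsto (fun n => (hX n).toLp) atTop (𝓝 hx.toLp) := by
  obtain ⟨τ, hτ, hτt⟩ := exists_tendsto_points hcr ht
  have hX : ∀ n, MemLp (fun ω => π.schauderSum (fun m κ => θ m κ ω) (τ n)) 2 P := fun n => by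
    simp only [schauderSum_eq_sum hcr.1 _ (hτ n)]
    exact memLp_sum_schauderLevel hθ n (τ n)
  refine ⟨τ, hτ, hτt, hX, exists_tendsto_toLp (c := fbmCov H t t - t * fbmCov H 1 t -
    t * fbmCov H t 1 + t * t) hX ?_ ?_⟩
  · filter_upwards [hcont] with ω hω
    exact (hω t ht).tendsto.comp (tendsto_nhdsWithin_iff.2
      ⟨hτt, Eventually.of_forall fun n => points_subset_Icc n (hτ n)⟩)
  · have h1 : ∀ p : ℕ × ℕ, ∫ ω, π.schauderSum (fun m κ => θ m κ ω) (τ p.1) *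
        π.schauderSum (fun m κ => θ m κ ω) (τ p.2) ∂P =
        fbmCov H (τ p.1) (τ p.2) - τ p.1 * fbmCov H 1 (τ p.2) - τ p.2 * fbmCov H (τ p.1) 1 +
          τ p.1 * τ p.2 := fun p => by
      have e1 := points_mono hcr.1 (le_max_left p.1 p.2) (hτ p.1)
      have e2 := points_mono hcr.1 (le_max_right p.1 p.2) (hτ p.2)
      rw [← integral_sum_schauderLevel_mul hcr.1 hH hθ hcov e2 e1]
      simp only [schauderSum_eq_sum hcr.1 _ e1, schauderSum_eq_sum hcr.1 _ e2]
    simp only [h1]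
    have hp1 : Tendsto (fun p : ℕ × ℕ => τ p.1) atTop (𝓝 t) := by
      rw [← prod_atTop_atTop_eq]; exact hτt.comp tendsto_fst
    have hp2 : Tendsto (fun p : ℕ × ℕ => τ p.2) atTop (𝓝 t) := by
      rw [← prod_atTop_atTop_eq]; exact hτt.comp tendsto_snd
    exact tendsto_bridgeCov hH hp1 hp2

theorem memLp_schauderSum (hcr : π.CompleteRefining) (hH : 0 < H)
    (hθ : ∀ m, ∀ κ ∈ π.I m, MemLp (θ m κ) 2 P)
    (hcov : ∀ m, ∀ κ ∈ π.I m, ∀ m', ∀ κ' ∈ π.I m',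
      ∫ ω, θ m κ ω * θ m' κ' ω ∂P = sigma π H m κ m' κ')
    (hcont : ∀ᵐ ω ∂P, ContinuousOn (π.schauderSum fun m κ => θ m κ ω) (Icc 0 1))
    (ht : t ∈ Icc (0 : ℝ) 1) :
    MemLp (fun ω => π.schauderSum (fun m κ => θ m κ ω) t) 2 P := by
  obtain ⟨τ, -, -, -, hx, -⟩ := exists_tendsto_toLp_schauderSum hcr hH hθ hcov hcont ht
  exact hx

theorem integral_schauderSum [IsFiniteMeasure P] (hcr : π.CompleteRefining) (hH : 0 < H)
    (hθ : ∀ m, ∀ κ ∈ π.I m, MemLp (θ m κ) 2 P)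
    (hmean : ∀ m, ∀ κ ∈ π.I m, ∫ ω, θ m κ ω ∂P = 0)
    (hcov : ∀ m, ∀ κ ∈ π.I m, ∀ m', ∀ κ' ∈ π.I m',
      ∫ ω, θ m κ ω * θ m' κ' ω ∂P = sigma π H m κ m' κ')
    (hcont : ∀ᵐ ω ∂P, ContinuousOn (π.schauderSum fun m κ => θ m κ ω) (Icc 0 1))
    (ht : t ∈ Icc (0 : ℝ) 1) :
    ∫ ω, π.schauderSum (fun m κ => θ m κ ω) t ∂P = 0 := by
  obtain ⟨τ, hτ, hτt, hX, hx, hlim⟩ := exists_tendsto_toLp_schauderSum hcr hH hθ hcov hcont ht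
  have h1 : MemLp (fun _ : Ω => (1 : ℝ)) 2 P := memLp_const 1
  have h2 := tendsto_integral_mul (hY := fun _ => h1) (hy := h1) hlim tendsto_const_nhds
  simp only [mul_one] at h2
  refine tendsto_nhds_unique h2 (tendsto_const_nhds.congr fun n => ?_)
  simp only [schauderSum_eq_sum hcr.1 _ (hτ n)]
  exact (integral_sum_schauderLevel hθ hmean n (τ n)).symm

/-- The Schauder series has the covariance of `B(t) - B(1) t`. -/
theorem integral_schauderSum_mul (hcr : π.CompleteRefining) (hH : 0 < H)
    (hθ : ∀ m, ∀ κ ∈ π.I m, MemLp (θ m κ) 2 P)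
    (hcov : ∀ m, ∀ κ ∈ π.I m, ∀ m', ∀ κ' ∈ π.I m',
      ∫ ω, θ m κ ω * θ m' κ' ω ∂P = sigma π H m κ m' κ')
    (hcont : ∀ᵐ ω ∂P, ContinuousOn (π.schauderSum fun m κ => θ m κ ω) (Icc 0 1))
    (hs : s ∈ Icc (0 : ℝ) 1) (ht : t ∈ Icc (0 : ℝ) 1) :
    ∫ ω, π.schauderSum (fun m κ => θ m κ ω) t * π.schauderSum (fun m κ => θ m κ ω) s ∂P =
      fbmCov H t s - t * fbmCov H 1 s - s * fbmCov H t 1 + t * s := by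
  obtain ⟨τ, hτ, hτt, hX, hx, hlim⟩ := exists_tendsto_toLp_schauderSum hcr hH hθ hcov hcont ht
  obtain ⟨ρ, hρ, hρs, hX', hx', hlim'⟩ := exists_tendsto_toLp_schauderSum hcr hH hθ hcov hcont hs
  refine tendsto_nhds_unique (tendsto_integral_mul hlim hlim') ?_
  have h1 : ∀ n, ∫ ω, π.schauderSum (fun m κ => θ m κ ω) (τ n) *
      π.schauderSum (fun m κ => θ m κ ω) (ρ n) ∂P =
      fbmCov H (τ n) (ρ n) - τ n * fbmCov H 1 (ρ n) - ρ n * fbmCov H (τ n) 1 + τ n * ρ n := by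
    intro n
    rw [← integral_sum_schauderLevel_mul hcr.1 hH hθ hcov (hρ n) (hτ n)]
    simp only [schauderSum_eq_sum hcr.1 _ (hτ n), schauderSum_eq_sum hcr.1 _ (hρ n)]
  simp only [h1]
  exact tendsto_bridgeCov hH hτt hρs

theorem integral_linear_mul_schauderSum (hcr : π.CompleteRefining) (hH : 0 < H)
    (hθ : ∀ m, ∀ κ ∈ π.I m, MemLp (θ m κ) 2 P)
    (hcov : ∀ m, ∀ κ ∈ π.I m, ∀ m', ∀ κ' ∈ π.I m',
      ∫ ω, θ m κ ω * θ m' κ' ω ∂P = sigma π H m κ m' κ')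
    (hcont : ∀ᵐ ω ∂P, ContinuousOn (π.schauderSum fun m κ => θ m κ ω) (Icc 0 1))
    {Z : Ω → ℝ} (hZ : MemLp Z 2 P)
    (hZcov : ∀ m, ∀ κ ∈ π.I m, ∫ ω, Z ω * θ m κ ω ∂P = sigmaLin π H m κ)
    (ht : t ∈ Icc (0 : ℝ) 1) :
    ∫ ω, Z ω * π.schauderSum (fun m κ => θ m κ ω) t ∂P = fbmCov H 1 t - t := by
  obtain ⟨τ, hτ, hτt, hX, hx, hlim⟩ := exists_tendsto_toLp_schauderSum hcr hH hθ hcov hcont ht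
  refine tendsto_nhds_unique
    (tendsto_integral_mul (hX := fun _ => hZ) (hx := hZ) tendsto_const_nhds hlim) ?_
  have h1 : ∀ n, ∫ ω, Z ω * π.schauderSum (fun m κ => θ m κ ω) (τ n) ∂P =
      fbmCov H 1 (τ n) - τ n := by
    intro n
    rw [← integral_linear_mul_sum_schauderLevel hcr.1 hH hθ hZ hZcov (hτ n)]
    simp only [schauderSum_eq_sum hcr.1 _ (hτ n)]
  simp only [h1]
  exact (tendsto_fbmCov hH tendsto_const_nhds hτt).sub hτt

end Moments

end PartitionSeq

/-! ### Increments -/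

theorem integral_sub_mul_sub {Ω : Type*} [MeasurableSpace Ω] {P : Measure Ω} {A B C D : Ω → ℝ}
    (hA : MemLp A 2 P) (hB : MemLp B 2 P) (hC : MemLp C 2 P) (hD : MemLp D 2 P) :
    ∫ ω, (A ω - B ω) * (C ω - D ω) ∂P =
      ∫ ω, A ω * C ω ∂P - ∫ ω, A ω * D ω ∂P - ∫ ω, B ω * C ω ∂P + ∫ ω, B ω * D ω ∂P := by
  have h1 : Integrable (fun ω => A ω * C ω) P := hA.integrable_mul hC
  have h2 : Integrable (fun ω => A ω * D ω) P := hA.integrable_mul hD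
  have h3 : Integrable (fun ω => B ω * C ω) P := hB.integrable_mul hC
  have h4 : Integrable (fun ω => B ω * D ω) P := hB.integrable_mul hD
  have h12 : Integrable (fun ω => A ω * C ω - A ω * D ω) P := h1.sub h2
  have h123 : Integrable (fun ω => A ω * C ω - A ω * D ω - B ω * C ω) P := h12.sub h3
  rw [← integral_sub h1 h2, ← integral_sub h12 h3, ← integral_add h123 h4]
  exact integral_congr_ae (Eventually.of_forall fun ω => by simp only; ring)

theorem _root_.StrictConvexOn.add_lt_add_of_increments {f : ℝ → ℝ}
    (hf : StrictConvexOn ℝ (Ici 0) f) {a h k : ℝ} (ha : 0 ≤ a) (hh : 0 < h) (hk : 0 < k) :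
    f (a + h) + f (a + k) < f a + f (a + h + k) := by
  have hhk : 0 < h + k := add_pos hh hk
  have hsum : k / (h + k) + h / (h + k) = 1 := by field_simp; ring
  have hsum' : h / (h + k) + k / (h + k) = 1 := by rw [add_comm, hsum]
  have hb : a + h + k ∈ Ici (0 : ℝ) := show 0 ≤ a + h + k by positivity
  have hne : a ≠ a + h + k := by linarith
  have h1 := hf.2 (show a ∈ Ici 0 from ha) hb hne (div_pos hk hhk) (div_pos hh hhk) hsum
  have h2 := hf.2 (show a ∈ Ici 0 from ha) hb hne (div_pos hh hhk) (div_pos hk hhk) hsum'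
  have e1 : (k / (h + k)) • a + (h / (h + k)) • (a + h + k) = a + h := by
    simp only [smul_eq_mul]; field_simp; ring
  have e2 : (h / (h + k)) • a + (k / (h + k)) • (a + h + k) = a + k := by
    simp only [smul_eq_mul]; field_simp; ring
  rw [e1] at h1
  rw [e2] at h2
  simp only [smul_eq_mul] at h1 h2
  have e3 : k / (h + k) * f a + h / (h + k) * f (a + h + k) +
      (h / (h + k) * f a + k / (h + k) * f (a + h + k)) =
      (k / (h + k) + h / (h + k)) * (f a + f (a + h + k)) := by ring
  rw [hsum, one_mul] at e3
  linarith

/-- Increments of fBM over consecutive intervals are uncorrelated only for `H = 1/2`, by strict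
convexity or strict concavity of `x ↦ x ^ (2 * H)`. -/
theorem increment_cov_eq_zero_iff {H : ℝ} (hH : H ∈ Ioo (0 : ℝ) 1) {s t u v : ℝ} (hst : s < t)
    (htu : t ≤ u) (huv : u < v) :
    |t - u| ^ (2 * H) + |s - v| ^ (2 * H) - |t - v| ^ (2 * H) - |s - u| ^ (2 * H) = 0 ↔
      H = 1 / 2 := by
  rw [abs_sub_comm t u, abs_sub_comm s v, abs_sub_comm t v, abs_sub_comm s u,
    abs_of_nonneg (by linarith), abs_of_nonneg (by linarith), abs_of_nonneg (by linarith),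
    abs_of_nonneg (by linarith)]
  have e1 : v - t = u - t + (v - u) := by ring
  have e2 : u - s = u - t + (t - s) := by ring
  have e3 : v - s = u - t + (v - u) + (t - s) := by ring
  constructor
  · intro h0
    rcases lt_trichotomy H (1 / 2) with hlt | he | hlt
    · have := (Real.strictConcaveOn_rpow (p := 2 * H) (by linarith [hH.1])
        (by linarith)).neg.add_lt_add_of_increments (sub_nonneg.2 htu) (sub_pos.2 huv)
        (sub_pos.2 hst)
      rw [← e3, ← e1, ← e2] at this
      simp only [Pi.neg_apply] at this
      linarith
    · exact he
    · have := (strictConvexOn_rpow (p := 2 * H) (by linarith)).add_lt_add_of_increments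
        (sub_nonneg.2 htu) (sub_pos.2 huv) (sub_pos.2 hst)
      rw [← e3, ← e1, ← e2] at this
      linarith
  · rintro rfl
    norm_num
    ring

/-! ### Scaled quadratic variation along uniform partitions -/

namespace PartitionSeq

variable {π : PartitionSeq}

theorem Uniform.t_eq (hu : π.Uniform) {n : ℕ} (hn : 1 ≤ n) {i : ℕ} (hi : i ≤ π.N n) :
    π.t n i = i * π.mesh n := by
  induction i with
  | zero => simp [π.t_first]
  | succ i ih =>
    have h1 := sub_le_mesh (π := π) (n := n) (i := i) hi
    have h2 := minMesh_le_sub (π := π) (n := n) (i := i) hi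
    rw [← hu n hn] at h2
    have h3 := ih (by omega)
    push_cast
    linarith

theorem Uniform.filter_eq_range (hu : π.Uniform) {n : ℕ} (hn : 1 ≤ n) {t : ℝ}
    (ht : t ∈ Icc (0 : ℝ) 1) :
    (Finset.range (π.N n)).filter (fun i => π.t n (i + 1) ≤ t) =
      Finset.range ⌊t / π.mesh n⌋₊ := by
  have hμ := mesh_pos (π := π) n
  have key : ∀ i, i + 1 ≤ ⌊t / π.mesh n⌋₊ ↔ ((i + 1 : ℕ) : ℝ) * π.mesh n ≤ t := fun i => by
    rw [Nat.le_floor_iff (div_nonneg ht.1 hμ.le), le_div_iff₀ hμ]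
  ext i
  rw [Finset.mem_filter, Finset.mem_range, Finset.mem_range, Nat.lt_iff_add_one_le (m := i)
    (n := ⌊t / π.mesh n⌋₊), key]
  constructor
  · rintro ⟨h1, h2⟩
    rwa [hu.t_eq hn h1] at h2
  · intro h1
    have h2 : i < π.N n := by
      by_contra! hc
      have h3 := hu.t_eq hn (i := π.N n) le_rfl
      rw [π.t_last] at h3
      have h4 : ((π.N n : ℕ) : ℝ) * π.mesh n < ((i + 1 : ℕ) : ℝ) * π.mesh n := by
        gcongr
        omega
      linarith [ht.2]
    exact ⟨h2, by rwa [hu.t_eq hn h2]⟩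

theorem tendsto_floor_mul_mesh (hcr : π.CompleteRefining) {t : ℝ} (ht : 0 ≤ t) :
    Tendsto (fun n => (⌊t / π.mesh n⌋₊ : ℝ) * π.mesh n) atTop (𝓝 t) := by
  have h1 : Tendsto (fun n => t - π.mesh n) atTop (𝓝 t) := by
    simpa using hcr.tendsto_mesh.const_sub t
  refine tendsto_of_tendsto_of_tendsto_of_le_of_le h1 tendsto_const_nhds (fun n => ?_) fun n => ?_
  · have h2 := Nat.lt_floor_add_one (t / π.mesh n)
    rw [div_lt_iff₀ (mesh_pos n)] at h2
    simp only
    linarith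
  · exact (le_div_iff₀ (mesh_pos n)).1 (Nat.floor_le (div_nonneg ht (mesh_pos n).le))

theorem inv_rpow_mul_eq {M μ H : ℝ} (hM : 0 < M) (hμ : 0 < μ) :
    M⁻¹ ^ (1 - 2 * H) * μ = (M * μ) ^ (2 * H - 1) * μ ^ (2 - 2 * H) := by
  have h1 : 1 - 2 * H = -(2 * H - 1) := by ring
  rw [h1, Real.rpow_neg (inv_nonneg.2 hM.le), Real.inv_rpow hM.le, inv_inv,
    Real.mul_rpow hM.le hμ.le, mul_assoc, ← Real.rpow_add hμ]
  have h2 : 2 * H - 1 + (2 - 2 * H) = 1 := by ring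
  rw [h2, Real.rpow_one]

section QV

variable {Ω : Type*} [MeasurableSpace Ω] {P : Measure Ω} {H : ℝ} {Y : ℝ → Ω → ℝ}

theorem Uniform.integral_scaledQV (hu : π.Uniform) (hY : ∀ t ∈ Icc (0 : ℝ) 1, MemLp (Y t) 2 P)
    {D : ℝ → ℝ → ℝ}
    (hD : ∀ s ∈ Icc (0 : ℝ) 1, ∀ t ∈ Icc (0 : ℝ) 1, ∫ ω, (Y t ω - Y s ω) ^ 2 ∂P = D s t)
    {n : ℕ} (hn : 1 ≤ n) {t : ℝ} (ht : t ∈ Icc (0 : ℝ) 1) :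
    ∫ ω, scaledQV π H Y n t ω ∂P = ((⌊t / π.mesh n⌋₊ : ℝ)⁻¹) ^ (1 - 2 * H) *
      ∑ i ∈ Finset.range ⌊t / π.mesh n⌋₊, D (i * π.mesh n) (((i + 1 : ℕ) : ℝ) * π.mesh n) := by
  have hmem : ∀ i ∈ Finset.range ⌊t / π.mesh n⌋₊, i + 1 ≤ π.N n := fun i hi => by
    rw [← hu.filter_eq_range hn ht, Finset.mem_filter, Finset.mem_range] at hi
    exact hi.1
  simp only [scaledQV, hu.filter_eq_range hn ht]
  rw [integral_const_mul, integral_finsetSum]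
  · congr 1
    refine Finset.sum_congr rfl fun i hi => ?_
    have h1 := hmem i hi
    rw [hD _ (t_mem_Icc (by omega)) _ (t_mem_Icc h1), hu.t_eq hn h1, hu.t_eq hn (by omega)]
  · intro i hi
    have h1 := hmem i hi
    exact ((hY _ (t_mem_Icc h1)).sub (hY _ (t_mem_Icc (by omega)))).integrable_sq

/-- Limit of the expected scaled quadratic variation when the variance of the increments is that of
fBM (`c = 0`) or that of `B(t) - B(1) t` (`c = 1`). The sum over the terms with factor `c` telescopes
to a correction that vanishes in the limit. -/
theorem Uniform.tendsto_integral_scaledQV (hu : π.Uniform) (hcr : π.CompleteRefining)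
    (hH : H ∈ Ioo (0 : ℝ) 1) (hY : ∀ t ∈ Icc (0 : ℝ) 1, MemLp (Y t) 2 P) (c : ℝ)
    (hD : ∀ s ∈ Icc (0 : ℝ) 1, ∀ t ∈ Icc (0 : ℝ) 1, ∫ ω, (Y t ω - Y s ω) ^ 2 ∂P =
      |t - s| ^ (2 * H) + c * ((t - s) ^ 2 - 2 * (t - s) * (fbmCov H 1 t - fbmCov H 1 s)))
    {t : ℝ} (ht : t ∈ Icc (0 : ℝ) 1) :
    Tendsto (fun n => ∫ ω, scaledQV π H Y n t ω ∂P) atTop (𝓝 (t ^ (2 * H))) := by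
  -- `M` increments over intervals of length `μ`
  have hsum : ∀ (M : ℕ) (μ : ℝ), 0 ≤ μ → ∑ i ∈ Finset.range M,
      (|((i + 1 : ℕ) : ℝ) * μ - i * μ| ^ (2 * H) + c * ((((i + 1 : ℕ) : ℝ) * μ - i * μ) ^ 2 -
        2 * (((i + 1 : ℕ) : ℝ) * μ - i * μ) *
          (fbmCov H 1 (((i + 1 : ℕ) : ℝ) * μ) - fbmCov H 1 (i * μ)))) =
      M * μ ^ (2 * H) + c * (μ * (M * μ - 2 * fbmCov H 1 (M * μ))) := by
    intro M μ hμ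
    induction M with
    | zero => simp [fbmCov_zero_right hH.1]
    | succ M ih =>
      have h1 : ((M + 1 : ℕ) : ℝ) * μ - M * μ = μ := by push_cast; ring
      rw [Finset.sum_range_succ, ih, h1, abs_of_nonneg hμ]
      push_cast
      ring
  -- at `t = 0` there are no summands, and `0 ^ (2 * H) = 0`
  rcases ht.1.eq_or_lt with rfl | ht0
  · refine tendsto_const_nhds.congr' ?_
    filter_upwards [eventually_ge_atTop 1] with n hn
    rw [hu.integral_scaledQV hY hD hn ht]
    simp [Real.zero_rpow (show 2 * H ≠ 0 by linarith [hH.1])]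
  have hlim := tendsto_floor_mul_mesh hcr ht.1
  have h1 : Tendsto (fun n => ((⌊t / π.mesh n⌋₊ : ℝ) * π.mesh n) ^ (2 * H) +
      ((⌊t / π.mesh n⌋₊ : ℝ) * π.mesh n) ^ (2 * H - 1) * π.mesh n ^ (2 - 2 * H) *
        (c * ((⌊t / π.mesh n⌋₊ : ℝ) * π.mesh n -
          2 * fbmCov H 1 ((⌊t / π.mesh n⌋₊ : ℝ) * π.mesh n)))) atTop
      (𝓝 (t ^ (2 * H) + t ^ (2 * H - 1) * 0 ^ (2 - 2 * H) * (c * (t - 2 * fbmCov H 1 t)))) :=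
    (hlim.rpow_const (Or.inl ht0.ne')).add
      (((hlim.rpow_const (Or.inl ht0.ne')).mul
        (hcr.tendsto_mesh.rpow_const (Or.inr (by linarith [hH.2])))).mul
        ((hlim.sub ((tendsto_fbmCov hH.1 tendsto_const_nhds hlim).const_mul 2)).const_mul c))
  rw [Real.zero_rpow (by linarith [hH.2]), mul_zero, zero_mul, add_zero] at h1
  refine h1.congr' ?_
  filter_upwards [eventually_ge_atTop 1, hlim.eventually (lt_mem_nhds ht0)] with n hn hpos
  have hμ := mesh_pos (π := π) n
  have hM : (0 : ℝ) < ⌊t / π.mesh n⌋₊ := pos_of_mul_pos_left hpos hμ.le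
  rw [hu.integral_scaledQV hY hD hn ht, hsum _ _ hμ.le]
  generalize (⌊t / π.mesh n⌋₊ : ℝ) = M at *
  have h2 := inv_rpow_mul_eq (H := H) hM hμ
  have h3 : M⁻¹ ^ (1 - 2 * H) * (M * π.mesh n ^ (2 * H)) = (M * π.mesh n) ^ (2 * H) := by
    have h4 : π.mesh n ^ (2 * H) = π.mesh n * π.mesh n ^ (2 * H - 1) := by
      rw [← Real.rpow_one_add' hμ.le (by linarith [hH.1])]
      congr 1
      ring
    have h5 : (M * π.mesh n) ^ (2 * H) = M * π.mesh n * (M * π.mesh n) ^ (2 * H - 1) := by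
      rw [← Real.rpow_one_add' hpos.le (by linarith [hH.1])]
      congr 1
      ring
    have h6 : π.mesh n ^ (2 - 2 * H) * π.mesh n ^ (2 * H - 1) = π.mesh n := by
      rw [← Real.rpow_add hμ]
      have : 2 - 2 * H + (2 * H - 1) = 1 := by ring
      rw [this, Real.rpow_one]
    calc _ = M * (M⁻¹ ^ (1 - 2 * H) * π.mesh n) * π.mesh n ^ (2 * H - 1) := by rw [h4]; ring
      _ = M * (M * π.mesh n) ^ (2 * H - 1) *
          (π.mesh n ^ (2 - 2 * H) * π.mesh n ^ (2 * H - 1)) := by rw [h2]; ring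
      _ = _ := by rw [h6, h5]; ring
  rw [mul_add, h3, ← h2]
  ring

end QV

end PartitionSeq

/-! ### The linear term and the two processes -/

/-- Adding a linear function does not leave `C^{H-}`, since `|s - t| ≤ |s - t| ^ α` on `[0, 1]`. -/
theorem InHolderMinus.linear_add {H : ℝ} (hH1 : H ≤ 1) {f : ℝ → ℝ} (hf : InHolderMinus H f)
    (z : ℝ) : InHolderMinus H fun t => z * t + f t := by
  refine ⟨(by fun_prop : Continuous fun t => z * t).continuousOn.add hf.1, fun α hα => ?_⟩
  obtain ⟨C, hC⟩ := hf.2 α hα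
  have hlin : HolderOnWith ‖z‖₊ α (fun t => z * t) (Icc 0 1) := by
    intro s hs t ht
    have h1 : |s - t| ≤ 1 := abs_sub_le_iff.2 ⟨by linarith [hs.2, ht.1], by linarith [hs.1, ht.2]⟩
    have h2 : |s - t| ≤ |s - t| ^ (α : ℝ) := by
      rcases (abs_nonneg (s - t)).eq_or_lt with h0 | h0
      · rw [← h0]
        exact Real.rpow_nonneg le_rfl _
      · simpa using Real.rpow_le_rpow_of_exponent_ge h0 h1 (by linarith : (α : ℝ) ≤ 1)
    rw [edist_dist, edist_dist, Real.dist_eq, Real.dist_eq,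
      ENNReal.ofReal_rpow_of_nonneg (abs_nonneg (s - t)) α.coe_nonneg, ← mul_sub, abs_mul,
      ENNReal.ofReal_mul (abs_nonneg z), ← Real.norm_eq_abs z, ofReal_norm, enorm_eq_nnnorm]
    gcongr
  refine ⟨‖z‖₊ + C, fun s hs t ht => (edist_add_add_le _ _ _ _).trans ?_⟩
  rw [ENNReal.coe_add, add_mul]
  exact add_le_add (hlin s hs t ht) (hC s hs t ht)

end FakeFBM

open FakeFBM

open FakeFBM.PartitionSeq in
theorem theorem6p1
    (π : PartitionSeq) (hbal : π.Balanced) (hcr : π.CompleteRefining)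
    (H : ℝ) (hH : H ∈ Set.Ioo (0 : ℝ) 1)
    {Ω : Type*} [MeasurableSpace Ω] (P : Measure Ω) [IsProbabilityMeasure P]
    (θ : ℕ → ℕ × ℕ → Ω → ℝ)
    (hmeas : ∀ m, ∀ κ ∈ π.I m, Measurable (θ m κ))
    (hmean : ∀ m, ∀ κ ∈ π.I m, ∫ ω, θ m κ ω ∂P = 0)
    (hcov : ∀ m, ∀ κ ∈ π.I m, ∀ m', ∀ κ' ∈ π.I m',
      ∫ ω, θ m κ ω * θ m' κ' ω ∂P = sigma π H m κ m' κ')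
    (htail : ∃ C₁ C₂ : ℝ, 0 < C₁ ∧ 0 < C₂ ∧ ∀ δ : ℝ, 0 < δ → ∀ m, ∀ κ ∈ π.I m,
      P.real {ω | δ < |θ m κ ω| * π.mesh (m + 1) ^ (1 / 2 - H)} ≤
        C₁ * Real.exp (-(δ ^ 2 / (2 * C₂))))
    (Y₀ : ℝ → Ω → ℝ)
    (hY₀ : ∀ t ω, Y₀ t ω = π.schauderSum (fun m κ => θ m κ ω) t) :
    -- Part 1, the process `Y₀` without linear term: almost surely the Schauder series converges
    -- uniformly to `Y₀`, which is continuous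
    ((∀ᵐ ω ∂P,
        TendstoUniformlyOn
          (fun n t => ∑ m ∈ Finset.range (n + 1), π.schauderLevel (fun m κ => θ m κ ω) m t)
          (fun t => Y₀ t ω) atTop (Set.Icc 0 1) ∧
        ContinuousOn (fun t => Y₀ t ω) (Set.Icc 0 1)) ∧
      -- mean and covariance are those of `B(t) - B(1) t`
      (∀ t ∈ Set.Icc (0 : ℝ) 1, MemLp (Y₀ t) 2 P ∧ ∫ ω, Y₀ t ω ∂P = 0) ∧
      (∀ s ∈ Set.Icc (0 : ℝ) 1, ∀ t ∈ Set.Icc (0 : ℝ) 1,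
        ∫ ω, Y₀ t ω * Y₀ s ω ∂P =
          fbmCov H t s - t * fbmCov H 1 s - s * fbmCov H t 1 + t * s) ∧
      -- Hölder regularity
      (∀ᵐ ω ∂P, InHolderMinus H (fun t => Y₀ t ω)) ∧
      -- the coefficients have the first two moments of those of any true fBM
      (∀ m, ∀ κ ∈ π.I m, MemLp (θ m κ) 2 P) ∧
      (∀ {Ω' : Type*} [MeasurableSpace Ω'] (P' : Measure Ω') [IsProbabilityMeasure P']
        (B : ℝ → Ω' → ℝ), IsFBM H B P' →
        (∀ m, ∀ κ ∈ π.I m,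
          ∫ ω, θ m κ ω ∂P = ∫ ω, π.schauderCoeff (fun t => B t ω) m κ ∂P') ∧
        (∀ m, ∀ κ ∈ π.I m, ∀ m', ∀ κ' ∈ π.I m',
          ∫ ω, θ m κ ω * θ m' κ' ω ∂P =
            ∫ ω, π.schauderCoeff (fun t => B t ω) m κ *
              π.schauderCoeff (fun t => B t ω) m' κ' ∂P')) ∧
      -- scaled quadratic variation along uniform partitions
      (π.Uniform → ∀ t ∈ Set.Icc (0 : ℝ) 1,
        Tendsto (fun n => ∫ ω, scaledQV π H Y₀ n t ω ∂P) atTop (𝓝 (t ^ (2 * H))))) ∧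
    -- Part 2: the process `Y` with linear term `Z t`
    (∀ Z : Ω → ℝ, Measurable Z → ∫ ω, Z ω ∂P = 0 → ∫ ω, Z ω ^ 2 ∂P = 1 →
      (∀ m, ∀ κ ∈ π.I m, ∫ ω, Z ω * θ m κ ω ∂P = sigmaLin π H m κ) →
      ∀ Y : ℝ → Ω → ℝ, (∀ t ω, Y t ω = Z ω * t + Y₀ t ω) →
      -- continuity
      (∀ᵐ ω ∂P, ContinuousOn (fun t => Y t ω) (Set.Icc 0 1)) ∧
      -- mean and covariance are those of fBM
      (∀ t ∈ Set.Icc (0 : ℝ) 1, MemLp (Y t) 2 P ∧ ∫ ω, Y t ω ∂P = 0) ∧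
      (∀ s ∈ Set.Icc (0 : ℝ) 1, ∀ t ∈ Set.Icc (0 : ℝ) 1,
        2 * ∫ ω, Y t ω * Y s ω ∂P =
          |t| ^ (2 * H) + |s| ^ (2 * H) - |t - s| ^ (2 * H)) ∧
      -- covariance of increments over consecutive intervals, which vanishes only for `H = 1/2`
      (∀ s t u v : ℝ, 0 ≤ s → s ≤ t → t ≤ u → u ≤ v → v ≤ 1 →
        2 * ∫ ω, (Y t ω - Y s ω) * (Y v ω - Y u ω) ∂P =
          |t - u| ^ (2 * H) + |s - v| ^ (2 * H) - |t - v| ^ (2 * H) - |s - u| ^ (2 * H) ∧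
        (s < t → u < v →
          (∫ ω, (Y t ω - Y s ω) * (Y v ω - Y u ω) ∂P = 0 ↔ H = 1 / 2))) ∧
      -- Hölder regularity
      (∀ᵐ ω ∂P, InHolderMinus H (fun t => Y t ω)) ∧
      -- the coefficient of the linear term has the moments of that of any true fBM
      MemLp Z 2 P ∧
      (∀ {Ω' : Type*} [MeasurableSpace Ω'] (P' : Measure Ω') [IsProbabilityMeasure P']
        (B : ℝ → Ω' → ℝ), IsFBM H B P' →
        ∫ ω, Z ω ∂P = ∫ ω, B 1 ω ∂P' ∧
        ∫ ω, Z ω ^ 2 ∂P = ∫ ω, B 1 ω ^ 2 ∂P' ∧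
        (∀ m, ∀ κ ∈ π.I m,
          ∫ ω, Z ω * θ m κ ω ∂P =
            ∫ ω, B 1 ω * π.schauderCoeff (fun t => B t ω) m κ ∂P')) ∧
      -- scaled quadratic variation along uniform partitions
      (π.Uniform → ∀ t ∈ Set.Icc (0 : ℝ) 1,
        Tendsto (fun n => ∫ ω, scaledQV π H Y n t ω ∂P) atTop (𝓝 (t ^ (2 * H))))) := by
  have hH0 : 0 < H := hH.1
  obtain rfl : Y₀ = fun t ω => π.schauderSum (fun m κ => θ m κ ω) t :=
    funext fun t => funext fun ω => hY₀ t ω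
  obtain ⟨C₁, C₂, hC₁, hC₂, htail⟩ := htail
  have hθ : ∀ m, ∀ κ ∈ π.I m, MemLp (θ m κ) 2 P := by
    intro m κ hκ
    have hc : 0 < π.mesh (m + 1) ^ (1 / 2 - H) := Real.rpow_pos_of_pos (mesh_pos _) _
    have h1 : MemLp (fun ω => θ m κ ω * π.mesh (m + 1) ^ (1 / 2 - H)) 2 P := by
      refine memLp_two_of_tail (C₁ := C₁) ((hmeas m κ hκ).mul_const _) hC₂ fun δ hδ => ?_
      simpa only [abs_mul, abs_of_pos hc] using htail δ hδ m κ hκ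
    have h2 := h1.mul_const (π.mesh (m + 1) ^ (1 / 2 - H))⁻¹
    simpa only [mul_inv_cancel_right₀ hc.ne'] using h2
  have hbound := ae_exists_coeff_bound hbal hcr hC₁ hC₂ htail
  have hunif : ∀ᵐ ω ∂P, TendstoUniformlyOn
      (fun n t => ∑ m ∈ Finset.range (n + 1), π.schauderLevel (fun m κ => θ m κ ω) m t)
      (π.schauderSum fun m κ => θ m κ ω) atTop (Icc 0 1) := by
    filter_upwards [hbound] with ω ⟨C, hC⟩
    exact tendstoUniformlyOn_schauderSum hbal hcr hH0 hH.2.le hC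
  have hholder : ∀ᵐ ω ∂P, InHolderMinus H (π.schauderSum fun m κ => θ m κ ω) := by
    filter_upwards [hbound] with ω ⟨C, hC⟩
    exact inHolderMinus_schauderSum hbal hcr hH0 hH.2.le hC
  have hcont : ∀ᵐ ω ∂P, ContinuousOn (π.schauderSum fun m κ => θ m κ ω) (Icc 0 1) :=
    hholder.mono fun ω h => h.1
  have hL2 : ∀ t ∈ Icc (0 : ℝ) 1, MemLp (fun ω => π.schauderSum (fun m κ => θ m κ ω) t) 2 P :=
    fun t ht => memLp_schauderSum hcr hH0 hθ hcov hcont ht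
  have hY0cov : ∀ s ∈ Icc (0 : ℝ) 1, ∀ t ∈ Icc (0 : ℝ) 1,
      ∫ ω, π.schauderSum (fun m κ => θ m κ ω) t * π.schauderSum (fun m κ => θ m κ ω) s ∂P =
        fbmCov H t s - t * fbmCov H 1 s - s * fbmCov H t 1 + t * s :=
    fun s hs t ht => integral_schauderSum_mul hcr hH0 hθ hcov hcont hs ht
  have hY0mean : ∀ t ∈ Icc (0 : ℝ) 1, ∫ ω, π.schauderSum (fun m κ => θ m κ ω) t ∂P = 0 :=
    fun t ht => integral_schauderSum hcr hH0 hθ hmean hcov hcont ht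
  refine ⟨⟨?_, fun t ht => ⟨hL2 t ht, hY0mean t ht⟩, hY0cov, hholder, hθ, ?_, ?_⟩, ?_⟩
  · filter_upwards [hunif, hcont] with ω h1 h2 using ⟨h1, h2⟩
  · intro Ω' _ P' _ B hB
    exact ⟨fun m κ hκ => by rw [hmean m κ hκ, hB.integral_schauderCoeff hκ],
      fun m κ hκ m' κ' hκ' => by
        rw [hcov m κ hκ m' κ' hκ', hB.integral_schauderCoeff_mul hκ hκ']⟩
  · intro hu t ht
    refine hu.tendsto_integral_scaledQV hcr hH hL2 1 (fun s hs t ht => ?_) ht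
    simp only [sq]
    rw [integral_sub_mul_sub (hL2 t ht) (hL2 s hs) (hL2 t ht) (hL2 s hs),
      hY0cov t ht t ht, hY0cov s hs t ht, hY0cov t ht s hs, hY0cov s hs s hs,
      fbmCov_self hH0, fbmCov_self hH0, fbmCov_comm H t 1, fbmCov_comm H s 1, fbmCov_comm H t s]
    have hst : 2 * fbmCov H s t = |s| ^ (2 * H) + |t| ^ (2 * H) - |t - s| ^ (2 * H) := by
      rw [fbmCov]; ring
    linear_combination -hst
  intro Z hZm hZmean hZsq hZcov Y hY
  obtain rfl : Y = fun t ω => Z ω * t + π.schauderSum (fun m κ => θ m κ ω) t :=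
    funext fun t => funext fun ω => hY t ω
  have hZ : MemLp Z 2 P := by
    rw [memLp_two_iff_integrable_sq hZm.aestronglyMeasurable]
    -- the integral of a function that is not integrable is `0`
    by_contra hc
    rw [integral_undef hc] at hZsq
    exact zero_ne_one hZsq
  have hZY := fun t (ht : t ∈ Icc (0 : ℝ) 1) =>
    integral_linear_mul_schauderSum hcr hH0 hθ hcov hcont hZ hZcov ht
  have hYL2 : ∀ t ∈ Icc (0 : ℝ) 1,
      MemLp (fun ω => Z ω * t + π.schauderSum (fun m κ => θ m κ ω) t) 2 P :=
    fun t ht => (hZ.mul_const t).add (hL2 t ht)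
  have hYcov : ∀ s ∈ Icc (0 : ℝ) 1, ∀ t ∈ Icc (0 : ℝ) 1,
      ∫ ω, (Z ω * t + π.schauderSum (fun m κ => θ m κ ω) t) *
        (Z ω * s + π.schauderSum (fun m κ => θ m κ ω) s) ∂P = fbmCov H t s := by
    intro s hs t ht
    -- sums as differences, to expand the product with `integral_sub_mul_sub`
    have hneg : ∀ t ∈ Icc (0 : ℝ) 1,
        MemLp (fun ω => -π.schauderSum (fun m κ => θ m κ ω) t) 2 P := fun t ht => (hL2 t ht).neg
    have h1 : ∀ ω, (Z ω * t + π.schauderSum (fun m κ => θ m κ ω) t) *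
        (Z ω * s + π.schauderSum (fun m κ => θ m κ ω) s) =
        (Z ω * t - -π.schauderSum (fun m κ => θ m κ ω) t) *
        (Z ω * s - -π.schauderSum (fun m κ => θ m κ ω) s) := fun ω => by simp
    have h2 : ∫ ω, Z ω * t * (Z ω * s) ∂P = t * s := by
      rw [← mul_one (t * s), ← hZsq, ← integral_const_mul]
      exact integral_congr_ae (Eventually.of_forall fun ω => by simp only; ring)
    have h3 : ∫ ω, Z ω * t * -π.schauderSum (fun m κ => θ m κ ω) s ∂P =
        -t * (fbmCov H 1 s - s) := by
      rw [← hZY s hs, ← integral_const_mul]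
      exact integral_congr_ae (Eventually.of_forall fun ω => by simp only; ring)
    have h4 : ∫ ω, -π.schauderSum (fun m κ => θ m κ ω) t * (Z ω * s) ∂P =
        -s * (fbmCov H 1 t - t) := by
      rw [← hZY t ht, ← integral_const_mul]
      exact integral_congr_ae (Eventually.of_forall fun ω => by simp only; ring)
    simp only [h1]
    rw [integral_sub_mul_sub (hZ.mul_const t) (hneg t ht) (hZ.mul_const s) (hneg s hs),
      h2, h3, h4]
    simp only [neg_mul_neg]
    rw [hY0cov s hs t ht, fbmCov_comm H t 1]
    ring
  refine ⟨?_, fun t ht => ⟨hYL2 t ht, ?_⟩, fun s hs t ht => ?_, ?_, ?_, hZ, ?_, ?_⟩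
  · filter_upwards [hcont] with ω hω
    exact (by fun_prop : Continuous fun t => Z ω * t).continuousOn.add hω
  · rw [integral_add ((hZ.integrable one_le_two).mul_const t) ((hL2 t ht).integrable one_le_two),
      integral_mul_const, hZmean, hY0mean t ht, zero_mul, add_zero]
  · rw [hYcov s hs t ht, fbmCov, abs_sub_comm s t]
    ring
  · intro s t u v hs hst htu huv hv
    have hs' : s ∈ Icc (0 : ℝ) 1 := ⟨by linarith, by linarith⟩
    have ht' : t ∈ Icc (0 : ℝ) 1 := ⟨by linarith, by linarith⟩
    have hu' : u ∈ Icc (0 : ℝ) 1 := ⟨by linarith, by linarith⟩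
    have hv' : v ∈ Icc (0 : ℝ) 1 := ⟨by linarith, by linarith⟩
    have hinc := integral_sub_mul_sub (hYL2 t ht') (hYL2 s hs') (hYL2 v hv') (hYL2 u hu')
    rw [hYcov v hv' t ht', hYcov u hu' t ht', hYcov v hv' s hs', hYcov u hu' s hs',
      ← fbmIncCov_eq] at hinc
    simp only [hinc]
    refine ⟨by rw [fbmIncCov]; ring, fun hst' huv' => ?_⟩
    rw [← increment_cov_eq_zero_iff hH hst' htu huv', fbmIncCov, div_eq_zero_iff]
    simp
  · filter_upwards [hholder] with ω hω
    exact hω.linear_add hH.2.le (Z ω)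
  · intro Ω' _ P' _ B hB
    have h1 : (1 : ℝ) ∈ Icc (0 : ℝ) 1 := ⟨zero_le_one, le_rfl⟩
    refine ⟨by rw [hZmean, hB.mean 1 h1], ?_, fun m κ hκ => ?_⟩
    · simp only [sq]
      rw [hB.cov 1 h1 1 h1, fbmCov_self hH0, abs_one, Real.one_rpow, ← hZsq]
      simp only [sq]
    · rw [hZcov m κ hκ, hB.integral_one_mul_schauderCoeff hH0 hκ]
  · intro hu t ht
    refine hu.tendsto_integral_scaledQV hcr hH hYL2 0 (fun s hs t ht => ?_) ht
    simp only [sq]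
    rw [integral_sub_mul_sub (hYL2 t ht) (hYL2 s hs) (hYL2 t ht) (hYL2 s hs),
      hYcov t ht t ht, hYcov s hs t ht, hYcov t ht s hs, hYcov s hs s hs,
      fbmCov_self hH0, fbmCov_self hH0, fbmCov_comm H t s]
    have hst : 2 * fbmCov H s t = |s| ^ (2 * H) + |t| ^ (2 * H) - |t - s| ^ (2 * H) := by
      rw [fbmCov]; ring
    linear_combination -hst
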